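/- Let $A$ and $B$ be quantum systems of finite dimensions $d_A$ and $d_B$, let $d=\min\{d_A,d_B\}$, and let $|\psi\rangle\in\mathbb{C}^{d_A}\otimes\mathbb{C}^{d_B}$ be a unit vector with $\psi=|\psi\rangle\langle\psi|$. Let $|\xi_\psi\rangle=(\alpha_1,\dots,\alpha_d)^T$ be the vector of its Schmidt coefficients: $\alpha_i\ge 0$ and $|\psi\rangle=\sum_{i=1}^d\alpha_i|e_i\rangle\otimes|f_i\rangle$ for some orthonormal families $(e_i)$ in $\mathbb{C}^{d_A}$ and $(f_i)$ in $\mathbb{C}^{d_B}$. For an integer $m\ge 1$ put $|\Psi_m\rangle=\frac1{\sqrt m}\sum_{i=1}^m|ii\rangle\in\mathbb{C}^m\otimes\mathbb{C}^m$ and $\Psi_m=|\Psi_m\rangle\langle\Psi_m|$. For a class $\mathcal O$ of completely positive trace-preserving (CPTP) maps define the fidelity of distillation $$F_{\mathcal O}(\rho,m)=\sup_{\Lambda\in\mathcal O}\operatorname{Tr}\big(\Lambda(\rho)\,\Psi_m\big),$$ where $\Lambda$ runs over the maps in $\mathcal O$ from $AB$ to $A'B'$ with $A'=B'=\mathbb{C}^m$.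 For $x\in\mathbb{C}^d$ define the $m$-distillation norm $$\|x\|_{[m]}=\min_{x=y+z}\ \|y\|_{\ell_1}+\sqrt m\,\|z\|_{\ell_2}.$$ Then, for every such $\psi$, every integer $m\ge 1$, and every class $\mathcal O\in\{1\text{-LOCC},\ \text{LOCC},\ \text{PPT},\ \text{Rains-preserving},\ \mathsf{PPT}_+\text{-preserving},\ \text{SEPP}\}$, $$F_{\mathcal O}(\psi,m)=\frac1m\,\big\|\,|\xi_\psi\rangle\big\|_{[m]}^2 .$$ Here the classes consist of the following maps $\Lambda:AB\to A'B'$. - 1-LOCC: $\Lambda=\sum_i E_i\otimes F_i$ (a finite sum) with $E_i:A\to A'$ completely positive, $\sum_iE_i$ trace-preserving, and each $F_i:B\to B'$ CPTP (communication from $A$ to $B$). - LOCC: maps realised by finitely many rounds, in each of which one party applies a finite-outcome instrument to its system and announces the outcome, on which all later steps may depend, followed by local CPTP maps. - PPT: CPTP maps whose Choi matrix satisfies $J_\Lambda^{T_{BB'}}\succeq 0$. - Rains-preserving: CPTP maps that send the set $\{X\succeq 0:\|X^{T_B}\|_1\le 1\}$ of $AB$ into that of $A'B'$. - $\mathsf{PPT}_+$-preserving: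 CPTP maps that send the set $\{X\succeq 0:\operatorname{Tr}X=1,\ X^{T_B}\succeq 0\}$ of $AB$ into that of $A'B'$. - SEPP: CPTP maps that send separable states (convex combinations of pure product states) of $AB$ to separable states of $A'B'$. -/

import Mathlib

open scoped MatrixOrder ComplexOrder

noncomputable section

namespace Distillation

/-- Linear maps between spaces of complex square matrices. -/
abbrev MatMap (ι κ : Type) : Type := Matrix ι ι ℂ →ₗ[ℂ] Matrix κ κ ℂ

section Maps

variable {ι κ α β α' β' : Type}

/-- `E ⊗ id`: apply `E` to the first tensor factor. -/
def ampLeft (β : Type) (E : MatMap α α') : MatMap (α × β) (α' × β) where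
  toFun X := Matrix.of fun p q => E (Matrix.of fun i j => X (i, p.2) (j, q.2)) p.1 q.1
  map_add' X Y := by
    ext p q
    exact congrFun (congrFun (E.map_add (Matrix.of fun i j => X (i, p.2) (j, q.2))
      (Matrix.of fun i j => Y (i, p.2) (j, q.2))) p.1) q.1
  map_smul' c X := by
    ext p q
    exact congrFun (congrFun (E.map_smul c (Matrix.of fun i j => X (i, p.2) (j, q.2))) p.1) q.1

/-- `id ⊗ F`: apply `F` to the second tensor factor. -/
def ampRight (α : Type) (F : MatMap β β') : MatMap (α × β) (α × β') where
  toFun X := Matrix.of fun p q => F (Matrix.of fun i j => X (p.1, i) (q.1, j)) p.2 q.2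
  map_add' X Y := by
    ext p q
    exact congrFun (congrFun (F.map_add (Matrix.of fun i j => X (p.1, i) (q.1, j))
      (Matrix.of fun i j => Y (p.1, i) (q.1, j))) p.2) q.2
  map_smul' c X := by
    ext p q
    exact congrFun (congrFun (F.map_smul c (Matrix.of fun i j => X (p.1, i) (q.1, j))) p.2) q.2

/-- The tensor product `E ⊗ F` of two maps. -/
def tensorMap (E : MatMap α α') (F : MatMap β β') : MatMap (α × β) (α' × β') :=
  ampLeft β' E ∘ₗ ampRight α F

/-- Complete positivity: `id_n ⊗ Λ` preserves positive semidefiniteness for every `n`. -/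
def IsCP (Λ : MatMap ι κ) : Prop :=
  ∀ (n : ℕ) (X : Matrix (Fin n × ι) (Fin n × ι) ℂ),
    X.PosSemidef → (ampRight (Fin n) Λ X).PosSemidef

/-- Trace preservation. -/
def IsTP [Fintype ι] [Fintype κ] (Λ : MatMap ι κ) : Prop :=
  ∀ X : Matrix ι ι ℂ, (Λ X).trace = X.trace

/-- Quantum channels: completely positive trace-preserving maps. -/
def IsCPTP [Fintype ι] [Fintype κ] (Λ : MatMap ι κ) : Prop :=
  IsCP Λ ∧ IsTP Λ

/-- Quantum instruments with finitely many outcomes: completely positive maps whose sum is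
trace-preserving. -/
def IsInstrument [Fintype ι] [Fintype κ] {k : ℕ} (E : Fin k → MatMap ι κ) : Prop :=
  (∀ i, IsCP (E i)) ∧ IsTP (∑ i, E i)

/-- The partial transpose `X ↦ X^{T_B}`. -/
def partialTranspose (X : Matrix (α × β) (α × β) ℂ) : Matrix (α × β) (α × β) ℂ :=
  Matrix.of fun p q => X (p.1, q.2) (q.1, p.2)

/-- The rank-one operator `|x⟩⟨x|`. -/
def proj (x : ι → ℂ) : Matrix ι ι ℂ := Matrix.vecMulVec x (star x)

/-- The trace norm `‖X‖₁ = Tr |X|`, where `|X| = (Xᴴ X)^{1/2}`. -/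
def traceNorm [Fintype ι] [DecidableEq ι] (X : Matrix ι ι ℂ) : ℝ :=
  (CFC.abs X).trace.re

/-- The Choi matrix `J_Λ = ∑ |i⟩⟨j| ⊗ Λ(|i⟩⟨j|)` of `Λ : AB → A'B'`, with its indices grouped
according to the bipartition `AA' | BB'`. -/
def choi [DecidableEq α] [DecidableEq β] (Λ : MatMap (α × β) (α' × β')) :
    Matrix ((α × α') × (β × β')) ((α × α') × (β × β')) ℂ :=
  Matrix.of fun p q =>
    Λ (Matrix.single (p.1.1, p.2.1) (q.1.1, q.2.1) 1) (p.1.2, p.2.2) (q.1.2, q.2.2)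

end Maps

section Sets

variable (α β : Type) [Fintype α] [Fintype β]

/-- Separable states: the convex hull of the pure product states. -/
def SEP : Set (Matrix (α × β) (α × β) ℂ) :=
  convexHull ℝ {X | ∃ (φ : EuclideanSpace ℂ α) (η : EuclideanSpace ℂ β), ‖φ‖ = 1 ∧ ‖η‖ = 1 ∧
    X = proj fun p : α × β => φ p.1 * η p.2}

/-- States with positive partial transpose. -/
def PPTplus : Set (Matrix (α × β) (α × β) ℂ) :=
  {X | X.trace = 1 ∧ X.PosSemidef ∧ (partialTranspose X).PosSemidef}

/-- The Rains set. -/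
def Rains [DecidableEq α] [DecidableEq β] : Set (Matrix (α × β) (α × β) ℂ) :=
  {X | X.PosSemidef ∧ traceNorm (partialTranspose X) ≤ 1}

end Sets

/-- One-way LOCC: Alice applies an instrument and sends its outcome `i` to Bob, who applies a
channel that may depend on `i`. -/
def IsOneWayLOCC {a b a' b' : ℕ} (Λ : MatMap (Fin a × Fin b) (Fin a' × Fin b')) : Prop :=
  ∃ (k : ℕ) (E : Fin k → MatMap (Fin a) (Fin a')) (F : Fin k → MatMap (Fin b) (Fin b')),
    IsInstrument E ∧ (∀ i, IsCPTP (F i)) ∧ Λ = ∑ i, tensorMap (E i) (F i)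

/-- LOCC: protocols with finitely many rounds. In a round one party applies an instrument to its
own system and announces the outcome, and all that follows may depend on it; at the end both
parties apply local channels. -/
inductive IsLOCC {a' b' : ℕ} :
    {a b : ℕ} → MatMap (Fin a × Fin b) (Fin a' × Fin b') → Prop
  | done {a b : ℕ} (E : MatMap (Fin a) (Fin a')) (F : MatMap (Fin b) (Fin b'))
      (hE : IsCPTP E) (hF : IsCPTP F) : IsLOCC (tensorMap E F)
  | alice {a b c k : ℕ} (E : Fin k → MatMap (Fin a) (Fin c)) (hE : IsInstrument E)
      (Λ : Fin k → MatMap (Fin c × Fin b) (Fin a' × Fin b')) (hΛ : ∀ i, IsLOCC (Λ i)) :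
      IsLOCC (∑ i, Λ i ∘ₗ ampLeft (Fin b) (E i))
  | bob {a b c k : ℕ} (F : Fin k → MatMap (Fin b) (Fin c)) (hF : IsInstrument F)
      (Λ : Fin k → MatMap (Fin a × Fin c) (Fin a' × Fin b')) (hΛ : ∀ i, IsLOCC (Λ i)) :
      IsLOCC (∑ i, Λ i ∘ₗ ampRight (Fin a) (F i))

/-- Names of the six classes of operations. -/
inductive OpClass
  | oneWayLOCC
  | LOCC
  | PPT
  | RainsPreserving
  | PPTplusPreserving
  | SEPP

/-- Membership of `Λ : AB → A'B'` in a class of operations. -/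
def OpClass.Mem {a b a' b' : ℕ} (Λ : MatMap (Fin a × Fin b) (Fin a' × Fin b')) :
    OpClass → Prop
  | .oneWayLOCC => IsOneWayLOCC Λ
  | .LOCC => IsLOCC Λ
  | .PPT => IsCPTP Λ ∧ (partialTranspose (choi Λ)).PosSemidef
  | .RainsPreserving => IsCPTP Λ ∧ ∀ X ∈ Rains (Fin a) (Fin b), Λ X ∈ Rains (Fin a') (Fin b')
  | .PPTplusPreserving =>
      IsCPTP Λ ∧ ∀ X ∈ PPTplus (Fin a) (Fin b), Λ X ∈ PPTplus (Fin a') (Fin b')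
  | .SEPP => IsCPTP Λ ∧ ∀ X ∈ SEP (Fin a) (Fin b), Λ X ∈ SEP (Fin a') (Fin b')

/-- The vector `|Ψ_m⟩ = m^{-1/2} ∑ |ii⟩` of the maximally entangled state. -/
def maxEntVec (m : ℕ) : Fin m × Fin m → ℂ :=
  fun p => if p.1 = p.2 then ((1 / √(m : ℝ) : ℝ) : ℂ) else 0

/-- The fidelity of distillation `F_O(ρ, m) = sup_{Λ ∈ O} ⟨Λ(ρ), Ψ_m⟩`. -/
def fidelity {a b : ℕ} (O : OpClass) (ρ : Matrix (Fin a × Fin b) (Fin a × Fin b) ℂ) (m : ℕ) : ℝ :=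
  sSup {t : ℝ | ∃ Λ : MatMap (Fin a × Fin b) (Fin m × Fin m), O.Mem Λ ∧
    t = (((Λ ρ).conjTranspose * proj (maxEntVec m)).trace).re}

/-- The `m`-distillation norm `min_{x = y + z} ‖y‖_{ℓ₁} + √m ‖z‖_{ℓ₂}`. -/
def distNorm {d : ℕ} (m : ℕ) (x : Fin d → ℂ) : ℝ :=
  sInf {t : ℝ | ∃ y z : Fin d → ℂ, x = y + z ∧
    t = ∑ i, ‖y i‖ + √(m : ℝ) * √(∑ i, ‖z i‖ ^ 2)}

/-- `ξ` is a vector of Schmidt coefficients of `ψ`: `ψ = ∑ ξ_i e_i ⊗ f_i` with `ξ_i ≥ 0` and with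
orthonormal families `e`, `f` of length `min a b`. -/
def IsSchmidtVector {a b : ℕ} (ψ : EuclideanSpace ℂ (Fin a × Fin b)) (ξ : Fin (min a b) → ℝ) :
    Prop :=
  ∃ (e : Fin (min a b) → EuclideanSpace ℂ (Fin a)) (f : Fin (min a b) → EuclideanSpace ℂ (Fin b)),
    Orthonormal ℂ e ∧ Orthonormal ℂ f ∧ (∀ i, 0 ≤ ξ i) ∧
      ∀ p, ψ p = ∑ i, (ξ i : ℂ) * (e i p.1 * f i p.2)

open Matrix in
theorem exists_schmidt_aux {a b : ℕ} (hab : a ≤ b) (M : Matrix (Fin a) (Fin b) ℂ) :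
    ∃ (ξ : Fin a → ℝ) (e : Fin a → EuclideanSpace ℂ (Fin a))
      (f : Fin a → EuclideanSpace ℂ (Fin b)),
      Orthonormal ℂ e ∧ Orthonormal ℂ f ∧ (∀ i, 0 ≤ ξ i) ∧
        ∀ p q, M p q = ∑ i, (ξ i : ℂ) * (e i p * f i q) := by
  classical
  have hps := Matrix.posSemidef_self_mul_conjTranspose M
  set hH := hps.isHermitian
  set e := hH.eigenvectorBasis with he
  set v : Fin a → EuclideanSpace ℂ (Fin b) :=
    fun i => WithLp.toLp 2 fun q => ∑ p, star (e i p) * M p q with hv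
  have hinner : ∀ i j, inner ℂ (v i) (v j) = if i = j then (hH.eigenvalues i : ℂ) else 0 := by
    intro i j
    have h1 : inner ℂ (v i) (v j) = inner ℂ (e j) (WithLp.toLp 2 ((M * Mᴴ) *ᵥ (e i).ofLp)) := by
      simp only [hv, PiLp.inner_apply, RCLike.inner_apply, map_sum, Matrix.mulVec, dotProduct,
        Matrix.mul_apply, conjTranspose_apply, Finset.sum_mul, Finset.mul_sum, map_mul,
        RCLike.star_def, RCLike.conj_conj]
      rw [Finset.sum_congr rfl fun q _ => Finset.sum_comm, Finset.sum_comm]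
      refine Finset.sum_congr rfl fun x _ => ?_
      rw [Finset.sum_comm]
      refine Finset.sum_congr rfl fun y _ => Finset.sum_congr rfl fun z _ => ?_
      ring
    rw [h1, hH.mulVec_eigenvectorBasis]
    have h2 : (WithLp.toLp 2 (hH.eigenvalues i • (e i).ofLp) : EuclideanSpace ℂ (Fin a)) =
        (hH.eigenvalues i : ℂ) • e i := by
      ext p; simp [Complex.real_smul]
    rw [h2, inner_smul_right, orthonormal_iff_ite.mp e.orthonormal]
    by_cases h : i = j
    · subst h; simp
    · simp [h, Ne.symm h]
  set s : Fin a → ℝ := fun i => √(hH.eigenvalues i) with hs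
  have hss : ∀ i, s i * s i = hH.eigenvalues i := fun i =>
    Real.mul_self_sqrt (hps.eigenvalues_nonneg i)
  -- normalised vectors, as a family on the larger index set
  set g : Fin b → EuclideanSpace ℂ (Fin b) := fun j =>
    if h : (j : ℕ) < a then ((s ⟨j, h⟩ : ℂ)⁻¹) • v ⟨j, h⟩ else 0 with hg
  set S : Set (Fin b) := {j | ∃ h : (j : ℕ) < a, s ⟨j, h⟩ ≠ 0} with hS
  have hortho : Orthonormal ℂ (S.domRestrict g) := by
    rw [orthonormal_iff_ite]
    rintro ⟨j, hj, hj0⟩ ⟨k, hk, hk0⟩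
    simp only [Set.domRestrict_apply, hg, hj, hk, dite_true, inner_smul_left, inner_smul_right,
      hinner, Subtype.mk.injEq, Fin.mk.injEq]
    by_cases h : (j : ℕ) = k
    · have h' : j = k := Fin.ext h
      subst h'
      have : (s ⟨j, hj⟩ : ℂ) ≠ 0 := by exact_mod_cast hj0
      simp only [if_true, ← hss, map_inv₀, Complex.conj_ofReal]
      push_cast
      field_simp
    · have h' : j ≠ k := fun hh => h (congrArg _ hh)
      simp [h, h']
  obtain ⟨B, hB⟩ := hortho.exists_orthonormalBasis_extension_of_card_eq (by simp)
  refine ⟨s, e, fun i => B (Fin.castLE hab i), e.orthonormal,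
    B.orthonormal.comp _ (Fin.castLE_injective hab), fun i => Real.sqrt_nonneg _, ?_⟩
  have hsv : ∀ i, (s i : ℂ) • B (Fin.castLE hab i) = v i := by
    intro i
    by_cases h : s i = 0
    · have : v i = 0 := by
        rw [← inner_self_eq_zero (𝕜 := ℂ), hinner]
        simp [← hss, h]
      simp [h, this]
    · have hmem : Fin.castLE hab i ∈ S := ⟨i.2, h⟩
      have h0 : (s i : ℂ) ≠ 0 := by exact_mod_cast h
      rw [hB _ hmem]
      simp [hg, smul_smul, h0]
  intro p q
  have h1 : ∀ i, (s i : ℂ) * (e i p * B (Fin.castLE hab i) q) = e i p * v i q := by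
    intro i
    rw [← hsv i]
    simp only [PiLp.smul_apply, smul_eq_mul]
    ring
  rw [Finset.sum_congr rfl fun i _ => h1 i]
  have h2 := congrArg (fun x : EuclideanSpace ℂ (Fin a) => x p)
    (e.sum_repr (WithLp.toLp 2 fun r => M r q))
  simp only [WithLp.ofLp_sum, Finset.sum_apply, PiLp.smul_apply, smul_eq_mul] at h2
  rw [← h2]
  refine Finset.sum_congr rfl fun i _ => ?_
  rw [mul_comm, e.repr_apply_apply]
  congr 1
  simp only [hv, PiLp.inner_apply, RCLike.inner_apply, RCLike.star_def]
  exact Finset.sum_congr rfl fun r _ => mul_comm _ _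

/-- Every vector has a Schmidt decomposition. -/
theorem exists_isSchmidtVector {a b : ℕ} (ψ : EuclideanSpace ℂ (Fin a × Fin b)) :
    ∃ ξ, IsSchmidtVector ψ ξ := by
  rcases le_total a b with h | h
  · obtain ⟨ξ, e, f, he, hf, h0, hM⟩ := exists_schmidt_aux h (Matrix.of fun p q => ψ (p, q))
    unfold IsSchmidtVector
    rw [min_eq_left h]
    exact ⟨ξ, e, f, he, hf, h0, fun p => hM p.1 p.2⟩
  · obtain ⟨ξ, e, f, he, hf, h0, hM⟩ := exists_schmidt_aux h (Matrix.of fun p q => ψ (q, p))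
    unfold IsSchmidtVector
    rw [min_eq_right h]
    refine ⟨ξ, f, e, hf, he, h0, fun p => (hM p.2 p.1).trans ?_⟩
    exact Finset.sum_congr rfl fun i _ => by ring

end Distillation

end

open scoped MatrixOrder ComplexOrder

noncomputable section

namespace Distillation

open Matrix
open scoped Kronecker

/-! ### Tensor amplifications, product matrices and complete positivity. -/

section Amplification

variable {ι κ α β α' β' : Type}

/-! Write `‖·‖` for the `m`-distillation norm. One upper bound and one protocol serve all six
classes.

Upper bound. A map in any class sends a pure product state to an output of overlap at most `1/m`
with `Ψ_m`: the partial transpose of `Ψ_m` is the swap divided by `m`, and the swap has eigenvalues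
`±1` (`OpClass.Mem.isProductBounded`). By positivity, `u ↦ ⟨Ψ_m|Λ(|u⟩⟨u|)|Ψ_m⟩` equals `‖T u‖²` for
a linear `T` (`exists_form_eq_norm_sq`). Trace preservation gives `‖T u‖ ≤ ‖u‖`, and `‖T u‖ ≤ 1/√m`
on unit product vectors. Split `ξ = y + z` along the Schmidt vectors, and apply the product bound to
each term of `y` and the contraction bound to `z` as a whole. The triangle inequality bounds `√m ‖T
ψ‖` by the cost of the splitting (`IsProductBounded.overlap_le`).

Lower bound. Some `w` in `[0,1]^d` with `∑ w_i² ≤ m` satisfies `‖ξ‖ ≤ ∑ w_i ξ_i`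
(`exists_dual_vector`). The vector of the `w_i²` is a mixture, with weights `l_k`, of indicators of
sets `S_k` of size at most `m` (`exists_subset_decomposition`). Alice measures with Kraus operators
that select `S_k` and rescale `e_i` by `√l_k / w_i`; Bob maps the matching `f_i` to the same basis
vectors. Outcome `k` contributes `l_k (∑_{i ∈ S_k} ξ_i / w_i)² / m`, and Jensen's inequality makes
the total at least `(∑ w_i ξ_i)² / m` (`exists_oneWayKraus_overlap_ge`). Such one-way protocols lie
in every class (`mem_oneWayKraus`). -/

theorem ampLeft_kronecker (E : MatMap α α') (A : Matrix α α ℂ) (B : Matrix β β ℂ) :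
    ampLeft β E (A ⊗ₖ B) = E A ⊗ₖ B := by
  ext p q
  have h : (of fun i j => (A ⊗ₖ B) (i, p.2) (j, q.2)) = B p.2 q.2 • A := by
    ext i j
    simp [mul_comm]
  change E (of fun i j => (A ⊗ₖ B) (i, p.2) (j, q.2)) p.1 q.1 = _
  rw [h, map_smul]
  simp [kroneckerMap_apply, mul_comm]

theorem ampRight_kronecker (F : MatMap β β') (A : Matrix α α ℂ) (B : Matrix β β ℂ) :
    ampRight α F (A ⊗ₖ B) = A ⊗ₖ F B := by
  ext p q
  have h : (of fun i j => (A ⊗ₖ B) (p.1, i) (q.1, j)) = A p.1 q.1 • B := by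
    ext i j
    simp
  change F (of fun i j => (A ⊗ₖ B) (p.1, i) (q.1, j)) p.2 q.2 = _
  rw [h, map_smul]
  simp [kroneckerMap_apply]

theorem tensorMap_kronecker (E : MatMap α α') (F : MatMap β β') (A : Matrix α α ℂ)
    (B : Matrix β β ℂ) : tensorMap E F (A ⊗ₖ B) = E A ⊗ₖ F B := by
  rw [tensorMap, LinearMap.comp_apply, ampRight_kronecker, ampLeft_kronecker]

/-- Linear maps on bipartite matrices are determined by their values on product matrices. -/
theorem linearMap_ext_kronecker [Fintype α] [Fintype β] [DecidableEq α] [DecidableEq β]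
    {M : Type*} [AddCommMonoid M] [Module ℂ M] {f g : Matrix (α × β) (α × β) ℂ →ₗ[ℂ] M}
    (h : ∀ A B, f (A ⊗ₖ B) = g (A ⊗ₖ B)) : f = g := by
  refine Matrix.ext_linearMap _ fun p q => LinearMap.ext fun c => ?_
  have hs : (single p q c : Matrix (α × β) (α × β) ℂ) = single p.1 q.1 c ⊗ₖ single p.2 q.2 1 := by
    rw [single_kronecker_single, mul_one]
  change f (single p q c) = g (single p q c)
  rw [hs, h]

theorem ampLeft_sum {σ : Type*} (s : Finset σ) (E : σ → MatMap α α') :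
    ampLeft β (∑ i ∈ s, E i) = ∑ i ∈ s, ampLeft β (E i) := by
  ext1 X
  ext p q
  simp [ampLeft, LinearMap.sum_apply, Matrix.sum_apply]

theorem ampRight_sum {σ : Type*} (s : Finset σ) (F : σ → MatMap β β') :
    ampRight α (∑ i ∈ s, F i) = ∑ i ∈ s, ampRight α (F i) := by
  ext1 X
  ext p q
  simp [ampRight, LinearMap.sum_apply, Matrix.sum_apply]

theorem ampLeft_comp_ampRight [Fintype α] [Fintype β] [DecidableEq α] [DecidableEq β]
    (E : MatMap α α') (F : MatMap β β') :
    ampLeft β' E ∘ₗ ampRight α F = ampRight α' F ∘ₗ ampLeft β E :=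
  linearMap_ext_kronecker fun A B => by
    simp only [LinearMap.comp_apply, ampRight_kronecker, ampLeft_kronecker]

theorem ampLeft_id : ampLeft β (LinearMap.id : MatMap α α) = LinearMap.id := by
  ext1 X
  ext p q
  simp [ampLeft]

theorem trace_ampRight [Fintype α] [Fintype β] [Fintype β'] {F : MatMap β β'} (hF : IsTP F)
    (X : Matrix (α × β) (α × β) ℂ) : (ampRight α F X).trace = X.trace := by
  simp only [trace, diag_apply, Fintype.sum_prod_type]
  exact Finset.sum_congr rfl fun i _ => hF (of fun j k => X (i, j) (i, k))

theorem trace_ampLeft [Fintype α] [Fintype β] [Fintype α'] {E : MatMap α α'} (hE : IsTP E)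
    (X : Matrix (α × β) (α × β) ℂ) : (ampLeft β E X).trace = X.trace := by
  simp only [trace, diag_apply, Fintype.sum_prod_type_right]
  exact Finset.sum_congr rfl fun i _ => hE (of fun j k => X (j, i) (k, i))

/-- `IsCP` places the ancilla on the left; reindexing by the swap moves it to the right. -/
theorem IsCP.posSemidef_ampLeft {E : MatMap α α'} (hE : IsCP E) {n : ℕ}
    {X : Matrix (α × Fin n) (α × Fin n) ℂ} (hX : X.PosSemidef) :
    (ampLeft (Fin n) E X).PosSemidef :=
  (hE n _ (hX.submatrix Prod.swap)).submatrix Prod.swap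

theorem IsCP.posSemidef {Λ : MatMap ι κ} (hΛ : IsCP Λ) {X : Matrix ι ι ℂ} (hX : X.PosSemidef) :
    (Λ X).PosSemidef :=
  (hΛ 1 _ (hX.submatrix Prod.snd)).submatrix fun i => ((0 : Fin 1), i)

theorem isCPTP_id [Fintype ι] : IsCPTP (LinearMap.id : MatMap ι ι) :=
  ⟨fun _ _ hX => hX, fun _ => rfl⟩

theorem isCP_sum {σ : Type*} [Fintype σ] {E : σ → MatMap ι κ} (hE : ∀ i, IsCP (E i)) :
    IsCP (∑ i, E i) := by
  intro n X hX
  rw [ampRight_sum, LinearMap.sum_apply]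
  exact posSemidef_sum _ fun i _ => hE i n X hX

end Amplification

/-! ### Kraus operators and their completion to channels. -/

section Kraus

variable {ι κ α β α' β' : Type}

/-- The completely positive map `X ↦ K X Kᴴ`. -/
def kraus [Fintype ι] (K : Matrix κ ι ℂ) : MatMap ι κ where
  toFun X := K * X * Kᴴ
  map_add' X Y := by rw [Matrix.mul_add, Matrix.add_mul]
  map_smul' c X := by simp

theorem kraus_apply [Fintype ι] (K : Matrix κ ι ℂ) (X : Matrix ι ι ℂ) :
    kraus K X = K * X * Kᴴ := rfl

theorem kraus_proj [Fintype ι] (K : Matrix κ ι ℂ) (v : ι → ℂ) :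
    kraus K (proj v) = proj (K *ᵥ v) := by
  rw [kraus_apply, proj, mul_vecMulVec, vecMulVec_mul, proj, star_mulVec]

variable [Fintype α] [Fintype β]

theorem kraus_kronecker [DecidableEq α] [DecidableEq β]
    (K : Matrix α' α ℂ) (L : Matrix β' β ℂ) (A : Matrix α α ℂ) (B : Matrix β β ℂ) :
    kraus (K ⊗ₖ L) (A ⊗ₖ B) = kraus K A ⊗ₖ kraus L B := by
  simp only [kraus_apply, conjTranspose_kronecker, mul_kronecker_mul]

theorem tensorMap_kraus [DecidableEq α] [DecidableEq β]
    (K : Matrix α' α ℂ) (L : Matrix β' β ℂ) :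
    tensorMap (kraus K) (kraus L) = kraus (K ⊗ₖ L) :=
  linearMap_ext_kronecker fun A B => by rw [tensorMap_kronecker, kraus_kronecker]

theorem isCP_kraus [DecidableEq α] [Fintype α'] (K : Matrix α' α ℂ) : IsCP (kraus K) := by
  intro n X hX
  have h : ampRight (Fin n) (kraus K) = kraus ((1 : Matrix (Fin n) (Fin n) ℂ) ⊗ₖ K) :=
    linearMap_ext_kronecker fun A B => by
      rw [ampRight_kronecker, kraus_kronecker, kraus_apply 1]
      simp
  rw [h]
  exact hX.mul_mul_conjTranspose_same _

theorem isTP_sum_kraus [DecidableEq α] [Fintype α'] {σ : Type*} [Fintype σ]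
    {K : σ → Matrix α' α ℂ} (hK : ∑ s, (K s)ᴴ * K s = 1) : IsTP (∑ s, kraus (K s)) := by
  intro X
  rw [LinearMap.sum_apply, trace_sum]
  have h : ∀ s, (kraus (K s) X).trace = ((K s)ᴴ * K s * X).trace := fun s => by
    rw [kraus_apply, trace_mul_comm, ← Matrix.mul_assoc]
  simp only [h]
  rw [← trace_sum, ← Finset.sum_mul, hK, Matrix.one_mul]

theorem isCPTP_sum_kraus [DecidableEq α] [Fintype α'] {σ : Type*} [Fintype σ]
    {K : σ → Matrix α' α ℂ} (hK : ∑ s, (K s)ᴴ * K s = 1) : IsCPTP (∑ s, kraus (K s)) :=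
  ⟨isCP_sum fun s => isCP_kraus (K s), isTP_sum_kraus hK⟩

/-- A family of Kraus operators with `∑ KᴴK ≤ 1` can be completed to a channel. -/
theorem exists_kraus_completion [DecidableEq α] [Fintype α'] [DecidableEq α']
    {σ : Type*} [Fintype σ] (K : σ → Matrix α' α ℂ) (hK : (1 - ∑ s, (K s)ᴴ * K s).PosSemidef) (x : α') :
    ∃ L : α → Matrix α' α ℂ, ∑ s, (K s)ᴴ * K s + ∑ j, (L j)ᴴ * L j = 1 := by
  obtain ⟨C, hC⟩ := CStarAlgebra.nonneg_iff_eq_star_mul_self.mp hK.nonneg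
  -- The defect is `CᴴC`; the rank-one operators built from the rows of `C` have the same sum of
  -- `LᴴL`, and all outputs are multiples of the basis vector `x`.
  refine ⟨fun j => vecMulVec (Pi.single x 1) (C j), ?_⟩
  have h : ∑ j, (vecMulVec (Pi.single x (1 : ℂ)) (C j))ᴴ * vecMulVec (Pi.single x 1) (C j) =
      star C * C := by
    ext p q
    simp [Matrix.sum_apply, Matrix.mul_apply, vecMulVec_apply, star_eq_conjTranspose,
      Pi.single_apply]
  rw [h, ← hC]
  abel

end Kraus

/-! ### Partial transposition, product states and separable states. -/

section PartialTranspose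

variable {α β α' β' : Type}

/-- The partial transpose as a linear map. -/
def partialTransposeₗ : MatMap (α × β) (α × β) where
  toFun := partialTranspose
  map_add' _ _ := rfl
  map_smul' _ _ := rfl

theorem partialTransposeₗ_apply (X : Matrix (α × β) (α × β) ℂ) :
    partialTransposeₗ X = partialTranspose X := rfl

theorem partialTranspose_kronecker (A : Matrix α α ℂ) (B : Matrix β β ℂ) :
    partialTranspose (A ⊗ₖ B) = A ⊗ₖ Bᵀ := rfl

theorem partialTranspose_sum {σ : Type*} (s : Finset σ) (X : σ → Matrix (α × β) (α × β) ℂ) :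
    partialTranspose (∑ i ∈ s, X i) = ∑ i ∈ s, partialTranspose (X i) :=
  map_sum partialTransposeₗ X s

theorem trace_partialTranspose [Fintype α] [Fintype β] (X : Matrix (α × β) (α × β) ℂ) :
    (partialTranspose X).trace = X.trace := rfl

theorem isHermitian_partialTranspose {X : Matrix (α × β) (α × β) ℂ} (hX : X.IsHermitian) :
    (partialTranspose X).IsHermitian :=
  Matrix.ext fun p q => hX.apply (p.1, q.2) (q.1, p.2)

theorem proj_mul_eq_kronecker (φ : α → ℂ) (η : β → ℂ) :
    proj (fun p : α × β => φ p.1 * η p.2) = proj φ ⊗ₖ proj η := by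
  ext p q
  simp only [proj, vecMulVec_apply, kroneckerMap_apply, Pi.star_apply, star_mul']
  ring

theorem posSemidef_proj [Finite α] (φ : α → ℂ) : (proj φ).PosSemidef :=
  posSemidef_vecMulVec_self_star φ

theorem trace_proj [Fintype α] (φ : α → ℂ) : (proj φ).trace = ((∑ i, ‖φ i‖ ^ 2 : ℝ) : ℂ) := by
  simp only [proj, trace, diag_apply, vecMulVec_apply, Pi.star_apply]
  push_cast
  exact Finset.sum_congr rfl fun i _ => Complex.mul_conj' _

theorem sum_norm_sq_eq_one [Fintype α] {φ : EuclideanSpace ℂ α} (h : ‖φ‖ = 1) :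
    ∑ i, ‖φ i‖ ^ 2 = 1 := by
  rw [← EuclideanSpace.norm_sq_eq, h, one_pow]

theorem trace_proj_mul_eq_one [Fintype α] [Fintype β] {φ : EuclideanSpace ℂ α}
    {η : EuclideanSpace ℂ β} (hφ : ‖φ‖ = 1) (hη : ‖η‖ = 1) :
    (proj fun p : α × β => φ p.1 * η p.2).trace = 1 := by
  rw [proj_mul_eq_kronecker, trace_kronecker, trace_proj, trace_proj, sum_norm_sq_eq_one hφ,
    sum_norm_sq_eq_one hη]
  simp

theorem posSemidef_partialTranspose_kronecker [Fintype α] [Fintype β] {A : Matrix α α ℂ}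
    {B : Matrix β β ℂ} (hA : A.PosSemidef) (hB : B.PosSemidef) :
    (partialTranspose (A ⊗ₖ B)).PosSemidef := by
  rw [partialTranspose_kronecker]
  exact hA.kronecker hB.transpose

theorem proj_mul_mem_PPTplus [Fintype α] [Fintype β] {φ : EuclideanSpace ℂ α}
    {η : EuclideanSpace ℂ β} (hφ : ‖φ‖ = 1) (hη : ‖η‖ = 1) :
    (proj fun p : α × β => φ p.1 * η p.2) ∈ PPTplus α β := by
  refine ⟨trace_proj_mul_eq_one hφ hη, posSemidef_proj _, ?_⟩
  rw [proj_mul_eq_kronecker]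
  exact posSemidef_partialTranspose_kronecker (posSemidef_proj _) (posSemidef_proj _)

theorem convex_PPTplus [Fintype α] [Fintype β] : Convex ℝ (PPTplus α β) := by
  rintro X ⟨hX1, hX2, hX3⟩ Y ⟨hY1, hY2, hY3⟩ s t hs ht hst
  refine ⟨?_, ?_, ?_⟩
  · rw [trace_add, trace_smul, trace_smul, hX1, hY1, ← add_smul, hst, one_smul]
  · exact (hX2.smul hs).add (hY2.smul ht)
  · exact (hX3.smul hs).add (hY3.smul ht)

theorem SEP_subset_PPTplus [Fintype α] [Fintype β] : SEP α β ⊆ PPTplus α β := by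
  refine convexHull_min ?_ convex_PPTplus
  rintro X ⟨φ, η, hφ, hη, rfl⟩
  exact proj_mul_mem_PPTplus hφ hη

end PartialTranspose

/-! ### Overlap with the maximally entangled state. -/

section Overlap

/-- With `Y = CᴴC`, this is the inequality of arithmetic and geometric means, applied to each row of
`C`. -/
theorem re_apply_le {ι : Type*} [Fintype ι] {Y : Matrix ι ι ℂ} (hY : Y.PosSemidef) (p q : ι) :
    |(Y p q).re| ≤ ((Y p p).re + (Y q q).re) / 2 := by
  classical
  obtain ⟨C, rfl⟩ := CStarAlgebra.nonneg_iff_eq_star_mul_self.mp hY.nonneg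
  simp only [star_eq_conjTranspose, Matrix.mul_apply, conjTranspose_apply, Complex.re_sum,
    ← Finset.sum_add_distrib, Finset.sum_div]
  refine (Finset.abs_sum_le_sum_abs _ _).trans (Finset.sum_le_sum fun k _ => ?_)
  simp only [Complex.mul_re, RCLike.star_def, Complex.conj_re, Complex.conj_im]
  rw [abs_le]
  constructor <;>
  nlinarith [sq_nonneg ((C k p).re - (C k q).re), sq_nonneg ((C k p).im - (C k q).im),
    sq_nonneg ((C k p).re + (C k q).re), sq_nonneg ((C k p).im + (C k q).im)]

/-- The overlap `⟨Ψ_m|X|Ψ_m⟩`. -/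
def overlap (m : ℕ) (X : Matrix (Fin m × Fin m) (Fin m × Fin m) ℂ) : ℝ :=
  (star (maxEntVec m) ⬝ᵥ X *ᵥ maxEntVec m).re

variable {m : ℕ}

/-- Taking the adjoint of `X` conjugates `⟨v|X|v⟩`, which the real part does not see; so `fidelity`
is about `overlap`. -/
theorem re_trace_conjTranspose_mul_proj {ι : Type} [Fintype ι] (X : Matrix ι ι ℂ) (v : ι → ℂ) :
    ((Xᴴ * proj v).trace).re = (star v ⬝ᵥ X *ᵥ v).re := by
  rw [proj, mul_vecMulVec, trace_vecMulVec, dotProduct_comm, ← Complex.conj_re]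
  congr 1
  rw [← Complex.star_def, ← star_dotProduct_star, star_star, star_mulVec,
    conjTranspose_conjTranspose, dotProduct_comm, dotProduct_mulVec]
  rw [dotProduct_comm, ← dotProduct_mulVec, dotProduct_mulVec, dotProduct_comm]

theorem overlap_sum {σ : Type*} (s : Finset σ)
    (X : σ → Matrix (Fin m × Fin m) (Fin m × Fin m) ℂ) :
    overlap m (∑ i ∈ s, X i) = ∑ i ∈ s, overlap m (X i) := by
  simp only [overlap, sum_mulVec, dotProduct_sum, Complex.re_sum]

theorem overlap_nonneg {X : Matrix (Fin m × Fin m) (Fin m × Fin m) ℂ} (hX : X.PosSemidef) :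
    0 ≤ overlap m X := hX.re_dotProduct_nonneg _

theorem overlap_eq (X : Matrix (Fin m × Fin m) (Fin m × Fin m) ℂ) :
    overlap m X = 1 / m * ∑ i, ∑ j, (X (i, i) (j, j)).re := by
  have h : ((1 / √(m : ℝ) : ℝ) : ℂ) * ((1 / √(m : ℝ) : ℝ) : ℂ) = ((1 / m : ℝ) : ℂ) := by
    rw [← Complex.ofReal_mul, div_mul_div_comm, one_mul, Real.mul_self_sqrt (Nat.cast_nonneg m)]
  have h2 : star (maxEntVec m) ⬝ᵥ X *ᵥ maxEntVec m =
      ((1 / m : ℝ) : ℂ) * ∑ i, ∑ j, X (i, i) (j, j) := by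
    simp only [dotProduct, mulVec, Fintype.sum_prod_type, Pi.star_apply, maxEntVec, mul_ite,
      mul_zero, Finset.sum_ite_eq, Finset.mem_univ, if_true, apply_ite (star : ℂ → ℂ), star_zero,
      ite_mul, zero_mul, RCLike.star_def, Complex.conj_ofReal, ← h, Finset.mul_sum,
      Finset.sum_ite_irrel, Finset.sum_const_zero]
    refine Finset.sum_congr rfl fun i _ => Finset.sum_congr rfl fun j _ => ?_
    ring
  rw [overlap, h2, Complex.re_ofReal_mul]
  simp only [Complex.re_sum]

theorem overlap_le_trace (hm : 1 ≤ m) {X : Matrix (Fin m × Fin m) (Fin m × Fin m) ℂ}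
    (hX : X.PosSemidef) : overlap m X ≤ X.trace.re := by
  have hm' : (0 : ℝ) < m := by exact_mod_cast hm
  have hd : ∀ p, 0 ≤ (X p p).re := fun p => (Complex.le_def.mp hX.diag_nonneg).1
  rw [overlap_eq, one_div, inv_mul_le_iff₀ hm']
  calc ∑ i, ∑ j, (X (i, i) (j, j)).re
      ≤ ∑ i : Fin m, ∑ j : Fin m, ((X (i, i) (i, i)).re + (X (j, j) (j, j)).re) / 2 :=
        Finset.sum_le_sum fun i _ => Finset.sum_le_sum fun j _ =>
          (le_abs_self _).trans (re_apply_le hX _ _)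
    _ = m * ∑ i : Fin m, (X (i, i) (i, i)).re := by
        simp only [add_div, Finset.sum_add_distrib, Finset.sum_const, Finset.card_univ,
          Fintype.card_fin, nsmul_eq_mul, ← Finset.mul_sum, ← Finset.sum_div]
        ring
    _ ≤ m * X.trace.re := by
        refine mul_le_mul_of_nonneg_left ?_ hm'.le
        simp only [trace, diag_apply, Complex.re_sum, Fintype.sum_prod_type]
        exact Finset.sum_le_sum fun i _ => Finset.single_le_sum
          (f := fun j => (X (i, j) (i, j)).re) (fun j _ => hd _) (Finset.mem_univ i)

/-- The pairing of a positive semidefinite matrix with the swap operator is at most its trace. -/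
theorem abs_sum_swap_le_trace {Y : Matrix (Fin m × Fin m) (Fin m × Fin m) ℂ}
    (hY : Y.PosSemidef) : |∑ i, ∑ j, (Y (i, j) (j, i)).re| ≤ Y.trace.re := by
  have h : Y.trace.re = ∑ i : Fin m, ∑ j : Fin m,
      ((Y (i, j) (i, j)).re + (Y (j, i) (j, i)).re) / 2 := by
    simp only [add_div, Finset.sum_add_distrib]
    rw [Finset.sum_comm (f := fun i j => (Y (j, i) (j, i)).re / 2)]
    simp only [trace, diag_apply, Complex.re_sum, Fintype.sum_prod_type, ← Finset.sum_div]
    ring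
  rw [h]
  refine (Finset.abs_sum_le_sum_abs _ _).trans (Finset.sum_le_sum fun i _ => ?_)
  exact (Finset.abs_sum_le_sum_abs _ _).trans (Finset.sum_le_sum fun j _ => re_apply_le hY _ _)

/-- Transposing the second factor turns `Ψ_m` into the swap operator divided by `m`. -/
theorem overlap_eq_partialTranspose (X : Matrix (Fin m × Fin m) (Fin m × Fin m) ℂ) :
    overlap m X = 1 / m * ∑ i, ∑ j, (partialTranspose X (i, j) (j, i)).re := overlap_eq X

theorem overlap_le_of_ppt {X : Matrix (Fin m × Fin m) (Fin m × Fin m) ℂ}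
    (hX : (partialTranspose X).PosSemidef) : overlap m X ≤ 1 / m * X.trace.re := by
  rw [overlap_eq_partialTranspose]
  exact mul_le_mul_of_nonneg_left ((le_abs_self _).trans (abs_sum_swap_le_trace hX)) (by positivity)

end Overlap

/-! ### The overlap after a positive map as a squared seminorm. -/

section QuadraticForm

theorem isHermitian_of_forall_nonneg {ι : Type*} [Fintype ι] {W : Matrix ι ι ℂ}
    (h : ∀ u : ι → ℂ, 0 ≤ star u ⬝ᵥ W *ᵥ u) : W.IsHermitian := by
  classical
  rw [← isSymmetric_toEuclideanLin_iff, LinearMap.isSymmetric_iff_inner_map_self_real]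
  intro u
  have := (Complex.le_def.mp (h u.ofLp)).2
  have hi : inner ℂ (toEuclideanLin W u) u = star (star u.ofLp ⬝ᵥ W *ᵥ u.ofLp) := by
    rw [EuclideanSpace.inner_eq_star_dotProduct, ← star_dotProduct_star, star_star,
      dotProduct_comm]
    rfl
  rw [hi, Complex.conj_eq_iff_im, Complex.star_def, Complex.conj_im, ← this]
  simp

/-- For a positive map `Λ`, the form `u ↦ ⟨v|Λ(|u⟩⟨u|)|v⟩` is the square of a Hilbert seminorm. -/
theorem exists_form_eq_norm_sq {ι κ : Type} [Fintype ι] [DecidableEq ι] [Fintype κ] (Λ : MatMap ι κ)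
    (hΛ : ∀ X, X.PosSemidef → (Λ X).PosSemidef) (v : κ → ℂ) :
    ∃ C : Matrix ι ι ℂ, ∀ u : ι → ℂ,
      (star v ⬝ᵥ Λ (proj u) *ᵥ v).re = ‖(WithLp.toLp 2 (C *ᵥ u) : EuclideanSpace ℂ ι)‖ ^ 2 := by
  -- The indices are exchanged because `|u⟩⟨u|` has the coefficient `u_q · conj u_p` at `(q, p)`.
  set W : Matrix ι ι ℂ := of fun p q => star v ⬝ᵥ Λ (single q p 1) *ᵥ v with hW
  have hform : ∀ u : ι → ℂ, star u ⬝ᵥ W *ᵥ u = star v ⬝ᵥ Λ (proj u) *ᵥ v := by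
    intro u
    have hp : proj u = ∑ q, ∑ p, (u q * star (u p)) • single q p (1 : ℂ) := by
      conv_lhs => rw [matrix_eq_sum_single (proj u)]
      simp [proj, vecMulVec_apply]
    rw [hp]
    simp only [map_sum, map_smul, sum_mulVec, dotProduct_sum, smul_mulVec, dotProduct_smul]
    simp only [dotProduct, mulVec, hW, of_apply, Finset.mul_sum, Pi.star_apply, smul_eq_mul]
    rw [Finset.sum_comm]
    refine Finset.sum_congr rfl fun q _ => Finset.sum_congr rfl fun p _ => ?_
    simp only [Finset.sum_mul, Finset.mul_sum]
    refine Finset.sum_congr rfl fun r _ => Finset.sum_congr rfl fun s _ => ?_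
    ring
  have hpos : ∀ u : ι → ℂ, 0 ≤ star u ⬝ᵥ W *ᵥ u := fun u => by
    rw [hform]
    exact (hΛ _ (posSemidef_proj u)).dotProduct_mulVec_nonneg v
  have hps : W.PosSemidef := .of_dotProduct_mulVec_nonneg (isHermitian_of_forall_nonneg hpos) hpos
  obtain ⟨C, hC⟩ := CStarAlgebra.nonneg_iff_eq_star_mul_self.mp hps.nonneg
  refine ⟨C, fun u => ?_⟩
  rw [← hform, hC, EuclideanSpace.norm_sq_eq, star_eq_conjTranspose, ← mulVec_mulVec,
    dotProduct_mulVec, ← star_mulVec]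
  simp only [dotProduct, Complex.re_sum, Pi.star_apply, RCLike.star_def, Complex.conj_mul']
  norm_cast

end QuadraticForm

/-! ### The trace norm as the least `Tr P + Tr N` over positive semidefinite splittings `P - N`. -/

section TraceNorm

variable {ι : Type} [Fintype ι] [DecidableEq ι]

theorem exists_posSemidef_sub {Y : Matrix ι ι ℂ} (hY : Y.IsHermitian) :
    ∃ P N : Matrix ι ι ℂ, P.PosSemidef ∧ N.PosSemidef ∧ Y = P - N ∧
      traceNorm Y = P.trace.re + N.trace.re := by
  refine ⟨Y⁺, Y⁻, (CFC.posPart_nonneg Y).posSemidef, (CFC.negPart_nonneg Y).posSemidef,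
    (CFC.posPart_sub_negPart Y hY.isSelfAdjoint).symm, ?_⟩
  rw [traceNorm, ← CFC.posPart_add_negPart Y hY.isSelfAdjoint, trace_add, Complex.add_re]

theorem traceNorm_eq_sum_abs_eigenvalues {H : Matrix ι ι ℂ} (hH : H.IsHermitian) :
    traceNorm H = ∑ i, |hH.eigenvalues i| := by
  rw [traceNorm, CFC.abs_eq_cfc_norm H hH.isSelfAdjoint, hH.cfc_eq, IsHermitian.cfc,
    Unitary.conjStarAlgAut_apply, trace_mul_cycle, Unitary.coe_star_mul_self, Matrix.one_mul,
    trace_diagonal]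
  simp

/-- In an eigenbasis of `P - N` each eigenvalue is a difference of nonnegative diagonal entries of
`P` and `N`, so its modulus is at most their sum. -/
theorem traceNorm_sub_le {P N : Matrix ι ι ℂ} (hP : P.PosSemidef) (hN : N.PosSemidef) :
    traceNorm (P - N) ≤ P.trace.re + N.trace.re := by
  have hH : (P - N).IsHermitian := hP.isHermitian.sub hN.isHermitian
  set U : Matrix ι ι ℂ := hH.eigenvectorUnitary.1
  have hUU : U * Uᴴ = 1 := Unitary.coe_mul_star_self hH.eigenvectorUnitary
  have hUU' : Uᴴ * U = 1 := Unitary.coe_star_mul_self hH.eigenvectorUnitary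
  have htr : ∀ X : Matrix ι ι ℂ, X.trace.re = ∑ i, ((Uᴴ * X * U) i i).re := fun X => by
    rw [← Complex.re_sum]
    change _ = (Uᴴ * X * U).trace.re
    rw [trace_mul_cycle, hUU, Matrix.one_mul]
  have hnn : ∀ {X : Matrix ι ι ℂ}, X.PosSemidef → ∀ i, 0 ≤ ((Uᴴ * X * U) i i).re := fun hX i =>
    (Complex.le_def.mp (hX.conjTranspose_mul_mul_same U).diag_nonneg).1
  have heig : ∀ i, hH.eigenvalues i = ((Uᴴ * P * U) i i).re - ((Uᴴ * N * U) i i).re := by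
    intro i
    rw [← Complex.sub_re, ← Matrix.sub_apply, ← Matrix.sub_mul, ← Matrix.mul_sub]
    have h := hH.spectral_theorem
    rw [Unitary.conjStarAlgAut_apply] at h
    have h2 : Uᴴ * (P - N) * U = diagonal (RCLike.ofReal ∘ hH.eigenvalues) := by
      conv_lhs => rw [h]
      change Uᴴ * (U * _ * Uᴴ) * U = _
      rw [Matrix.mul_assoc U, ← Matrix.mul_assoc Uᴴ U, hUU', Matrix.one_mul, Matrix.mul_assoc, hUU',
        Matrix.mul_one]
    rw [h2]
    simp
  rw [traceNorm_eq_sum_abs_eigenvalues hH, htr P, htr N, ← Finset.sum_add_distrib]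
  refine Finset.sum_le_sum fun i _ => ?_
  rw [heig, abs_le]
  constructor <;> linarith [hnn hP i, hnn hN i]

theorem traceNorm_of_posSemidef {X : Matrix ι ι ℂ} (hX : X.PosSemidef) :
    traceNorm X = X.trace.re := by
  rw [traceNorm, CFC.abs_of_nonneg X hX.nonneg]

end TraceNorm

/-! ### The upper bound, common to all classes. -/

section UpperBound

variable {a b m : ℕ}

/-- Positive trace-preserving maps whose outputs on pure product states have overlap at most
`1 / m` with the maximally entangled state. -/
def IsProductBounded (m : ℕ) (Λ : MatMap (Fin a × Fin b) (Fin m × Fin m)) : Prop :=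
  (∀ X, X.PosSemidef → (Λ X).PosSemidef) ∧ IsTP Λ ∧
    ∀ (φ : EuclideanSpace ℂ (Fin a)) (η : EuclideanSpace ℂ (Fin b)), ‖φ‖ = 1 → ‖η‖ = 1 →
      overlap m (Λ (proj fun p : Fin a × Fin b => φ p.1 * η p.2)) ≤ 1 / m

theorem orthonormal_tensor {σ : Type*} {e : σ → EuclideanSpace ℂ (Fin a)}
    {f : σ → EuclideanSpace ℂ (Fin b)} (he : Orthonormal ℂ e) (hf : Orthonormal ℂ f) :
    Orthonormal ℂ fun i =>
      (WithLp.toLp 2 fun p => e i p.1 * f i p.2 : EuclideanSpace ℂ (Fin a × Fin b)) := by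
  classical
  rw [orthonormal_iff_ite] at *
  intro i j
  have h : inner ℂ (WithLp.toLp 2 fun p => e i p.1 * f i p.2 : EuclideanSpace ℂ (Fin a × Fin b))
      (WithLp.toLp 2 fun p => e j p.1 * f j p.2) = inner ℂ (e i) (e j) * inner ℂ (f i) (f j) := by
    simp only [PiLp.inner_apply, RCLike.inner_apply, map_mul, Fintype.sum_prod_type,
      Finset.sum_mul_sum]
    exact Finset.sum_congr rfl fun x _ => Finset.sum_congr rfl fun y _ => by ring
  rw [h, he, hf]
  by_cases hij : i = j <;> simp [hij]

/-- The seminorm `‖T u‖` is at most `1/√m` on each Schmidt product vector and at most `‖u‖`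
everywhere. The `y` part is bounded term by term, the `z` part as one vector. -/
theorem IsProductBounded.overlap_le {Λ : MatMap (Fin a × Fin b) (Fin m × Fin m)}
    (hΛ : IsProductBounded m Λ) (hm : 1 ≤ m) {ψ : EuclideanSpace ℂ (Fin a × Fin b)}
    {ξ : Fin (min a b) → ℝ} (hξ : IsSchmidtVector ψ ξ) {y z : Fin (min a b) → ℂ}
    (hyz : (fun i => (ξ i : ℂ)) = y + z) :
    √(m * overlap m (Λ (proj ψ))) ≤ ∑ i, ‖y i‖ + √(m : ℝ) * √(∑ i, ‖z i‖ ^ 2) := by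
  obtain ⟨hpos, htp, hprod⟩ := hΛ
  obtain ⟨e, f, he, hf, -, hψ⟩ := hξ
  have hm' : (0 : ℝ) < m := by exact_mod_cast hm
  obtain ⟨C, hC⟩ := exists_form_eq_norm_sq Λ hpos (maxEntVec m)
  set T : EuclideanSpace ℂ (Fin a × Fin b) →ₗ[ℂ] EuclideanSpace ℂ (Fin a × Fin b) :=
    toEuclideanLin C with hT
  have hov : ∀ u : EuclideanSpace ℂ (Fin a × Fin b), overlap m (Λ (proj u)) = ‖T u‖ ^ 2 :=
    fun u => hC u
  set g : Fin (min a b) → EuclideanSpace ℂ (Fin a × Fin b) :=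
    fun i => WithLp.toLp 2 fun p => e i p.1 * f i p.2 with hg
  have hgo : Orthonormal ℂ g := orthonormal_tensor he hf
  have hTg : ∀ i, √(m : ℝ) * ‖T (g i)‖ ≤ 1 := fun i => by
    have h1 : ‖T (g i)‖ ^ 2 ≤ 1 / m := by
      rw [← hov]
      exact hprod (e i) (f i) (he.1 i) (hf.1 i)
    rw [← abs_of_nonneg (by positivity : 0 ≤ √(m : ℝ) * ‖T (g i)‖), ← sq_le_one_iff_abs_le_one,
      mul_pow, Real.sq_sqrt hm'.le]
    calc m * ‖T (g i)‖ ^ 2 ≤ m * (1 / m) := by gcongr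
      _ = 1 := by field_simp
  have hTle : ∀ u, ‖T u‖ ≤ ‖u‖ := fun u => by
    refine le_of_sq_le_sq ?_ (norm_nonneg _)
    rw [← hov]
    refine (overlap_le_trace hm (hpos _ (posSemidef_proj _))).trans ?_
    rw [htp, trace_proj, Complex.ofReal_re, EuclideanSpace.norm_sq_eq]
  have hψ' : ψ = ∑ i, y i • g i + ∑ i, z i • g i := by
    ext p
    rw [hψ p, ← Finset.sum_add_distrib]
    simp only [← add_smul, WithLp.ofLp_sum, Finset.sum_apply, PiLp.smul_apply, smul_eq_mul]
    exact Finset.sum_congr rfl fun i _ => by rw [congrFun hyz i]; rfl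
  have hz : ‖∑ i, z i • g i‖ = √(∑ i, ‖z i‖ ^ 2) := by
    rw [norm_eq_sqrt_re_inner (𝕜 := ℂ), hgo.inner_sum]
    simp only [Complex.conj_mul', ← Complex.ofReal_pow, ← Complex.ofReal_sum, RCLike.re_to_complex,
      Complex.ofReal_re]
  rw [hov, Real.sqrt_mul hm'.le, Real.sqrt_sq (norm_nonneg _), hψ', map_add, map_sum]
  calc √(m : ℝ) * ‖∑ i, T (y i • g i) + T (∑ i, z i • g i)‖
      ≤ √(m : ℝ) * (∑ i, ‖y i‖ * ‖T (g i)‖ + ‖∑ i, z i • g i‖) := by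
        gcongr
        refine (norm_add_le _ _).trans (add_le_add ((norm_sum_le _ _).trans_eq ?_) (hTle _))
        simp only [map_smul, norm_smul]
    _ = ∑ i, ‖y i‖ * (√(m : ℝ) * ‖T (g i)‖) + √(m : ℝ) * √(∑ i, ‖z i‖ ^ 2) := by
        rw [mul_add, hz, Finset.mul_sum]
        congr 1
        exact Finset.sum_congr rfl fun i _ => by ring
    _ ≤ _ := by
        gcongr with i
        exact mul_le_of_le_one_right (norm_nonneg _) (hTg i)

theorem isProductBounded_of_ppt {Λ : MatMap (Fin a × Fin b) (Fin m × Fin m)}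
    (hpos : ∀ X, X.PosSemidef → (Λ X).PosSemidef) (htp : IsTP Λ)
    (h : ∀ (φ : EuclideanSpace ℂ (Fin a)) (η : EuclideanSpace ℂ (Fin b)), ‖φ‖ = 1 → ‖η‖ = 1 →
      (partialTranspose (Λ (proj fun p : Fin a × Fin b => φ p.1 * η p.2))).PosSemidef) :
    IsProductBounded m Λ := by
  refine ⟨hpos, htp, fun φ η hφ hη => (overlap_le_of_ppt (h φ η hφ hη)).trans_eq ?_⟩
  rw [htp, trace_proj_mul_eq_one hφ hη]
  simp

theorem IsCP.posSemidef_tensorMap {a' b' : ℕ} {E : MatMap (Fin a) (Fin a')}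
    {F : MatMap (Fin b) (Fin b')} (hE : IsCP E) (hF : IsCP F)
    {X : Matrix (Fin a × Fin b) (Fin a × Fin b) ℂ} (hX : X.PosSemidef) :
    (tensorMap E F X).PosSemidef :=
  hE.posSemidef_ampLeft (hF a X hX)

/-- Each round turns a product of positive matrices into a sum of such products, so the claim on
product inputs passes through the induction. -/
theorem IsLOCC.isTP_and_ppt {a' b' : ℕ} {Λ : MatMap (Fin a × Fin b) (Fin a' × Fin b')}
    (h : IsLOCC Λ) :
    (∀ X, X.PosSemidef → (Λ X).PosSemidef) ∧ IsTP Λ ∧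
      ∀ A B, A.PosSemidef → B.PosSemidef → (partialTranspose (Λ (A ⊗ₖ B))).PosSemidef := by
  induction h with
  | done E F hE hF =>
    refine ⟨fun X hX => hE.1.posSemidef_tensorMap hF.1 hX, fun X => ?_, fun A B hA hB => ?_⟩
    · rw [tensorMap, LinearMap.comp_apply, trace_ampLeft hE.2, trace_ampRight hF.2]
    · rw [tensorMap_kronecker]
      exact posSemidef_partialTranspose_kronecker (hE.1.posSemidef hA) (hF.1.posSemidef hB)
  | alice E hE Λ _ ih =>
    refine ⟨fun X hX => ?_, fun X => ?_, fun A B hA hB => ?_⟩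
    · rw [LinearMap.sum_apply]
      exact posSemidef_sum _ fun i _ => (ih i).1 _ ((hE.1 i).posSemidef_ampLeft hX)
    · simp only [LinearMap.sum_apply, LinearMap.comp_apply, trace_sum, (ih _).2.1 _]
      rw [← trace_sum, ← LinearMap.sum_apply, ← ampLeft_sum, trace_ampLeft hE.2]
    · simp only [LinearMap.sum_apply, LinearMap.comp_apply, partialTranspose_sum, ampLeft_kronecker]
      exact posSemidef_sum _ fun i _ => (ih i).2.2 _ _ ((hE.1 i).posSemidef hA) hB
  | bob F hF Λ _ ih =>
    refine ⟨fun X hX => ?_, fun X => ?_, fun A B hA hB => ?_⟩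
    · rw [LinearMap.sum_apply]
      exact posSemidef_sum _ fun i _ => (ih i).1 _ (hF.1 i _ X hX)
    · simp only [LinearMap.sum_apply, LinearMap.comp_apply, trace_sum, (ih _).2.1 _]
      rw [← trace_sum, ← LinearMap.sum_apply, ← ampRight_sum, trace_ampRight hF.2]
    · simp only [LinearMap.sum_apply, LinearMap.comp_apply, partialTranspose_sum,
        ampRight_kronecker]
      exact posSemidef_sum _ fun i _ => (ih i).2.2 _ _ hA ((hF.1 i).posSemidef hB)

theorem IsOneWayLOCC.isLOCC {a' b' : ℕ} {Λ : MatMap (Fin a × Fin b) (Fin a' × Fin b')}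
    (h : IsOneWayLOCC Λ) : IsLOCC Λ := by
  obtain ⟨k, E, F, hE, hF, rfl⟩ := h
  have hcomp : ∀ i, tensorMap (E i) (F i) =
      tensorMap LinearMap.id (F i) ∘ₗ ampLeft (Fin b) (E i) := fun i => by
    rw [tensorMap, ampLeft_comp_ampRight, tensorMap, ampLeft_id, LinearMap.id_comp]
  simp only [hcomp]
  exact .alice E hE _ fun i => .done _ _ isCPTP_id (hF i)

/-- A map with positive partially transposed Choi matrix sends product states to states with
positive partial transpose. -/
theorem posSemidef_partialTranspose_of_choi {a' b' : ℕ}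
    {Λ : MatMap (Fin a × Fin b) (Fin a' × Fin b')}
    (h : (partialTranspose (choi Λ)).PosSemidef) (φ : Fin a → ℂ) (η : Fin b → ℂ) :
    (partialTranspose (Λ (proj fun p : Fin a × Fin b => φ p.1 * η p.2))).PosSemidef := by
  -- `M` contracts the input indices of the Choi matrix with `φ` and with the conjugate of `η`; the
  -- conjugate appears because the partial transpose also exchanges Bob's input indices.
  set M : Matrix (Fin a' × Fin b') ((Fin a × Fin a') × (Fin b × Fin b')) ℂ :=
    of fun p r => if r.1.2 = p.1 ∧ r.2.2 = p.2 then φ r.1.1 * star (η r.2.1) else 0 with hM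
  convert h.mul_mul_conjTranspose_same M using 1
  have hp : (proj fun p : Fin a × Fin b => φ p.1 * η p.2) =
      ∑ i, ∑ j, ∑ k, ∑ l, (φ i * η j * star (φ k * η l)) • single (i, j) (k, l) (1 : ℂ) := by
    conv_lhs => rw [matrix_eq_sum_single (proj fun p : Fin a × Fin b => φ p.1 * η p.2)]
    simp [proj, vecMulVec_apply, Fintype.sum_prod_type]
  ext p q
  rw [hp]
  simp only [map_sum, map_smul, partialTranspose, of_apply, Matrix.sum_apply, Matrix.smul_apply,
    Matrix.mul_apply, hM, conjTranspose_apply, choi, smul_eq_mul, Fintype.sum_prod_type, ite_and,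
    apply_ite (star : ℂ → ℂ), star_zero, ite_mul, mul_ite, zero_mul, mul_zero, Finset.sum_ite_irrel, Finset.sum_const_zero,
    Finset.sum_ite_eq', Finset.mem_univ, if_true, Finset.sum_mul]
  refine (Finset.sum_comm.trans ((Finset.sum_congr rfl fun j _ => Finset.sum_comm).trans
    Finset.sum_comm)).trans ?_
  refine Finset.sum_congr rfl fun k _ => Finset.sum_congr rfl fun j _ =>
    Finset.sum_congr rfl fun i _ => Finset.sum_congr rfl fun l _ => ?_
  simp only [star_mul', star_star]
  ring

/-- Pairing the swap with `P - N`, the Jordan decomposition of the partial transpose, gives at most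
`Tr P + Tr N`, which is its trace norm. -/
theorem overlap_le_of_mem_Rains {X : Matrix (Fin m × Fin m) (Fin m × Fin m) ℂ}
    (hX : X ∈ Rains (Fin m) (Fin m)) : overlap m X ≤ 1 / m := by
  obtain ⟨P, N, hP, hN, hPN, htr⟩ :=
    exists_posSemidef_sub (isHermitian_partialTranspose hX.1.isHermitian)
  have h : ∑ i, ∑ j, (partialTranspose X (i, j) (j, i)).re ≤ 1 := by
    have h1 : ∑ i, ∑ j, (partialTranspose X (i, j) (j, i)).re =
        ∑ i, ∑ j, (P (i, j) (j, i)).re - ∑ i, ∑ j, (N (i, j) (j, i)).re := by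
      simp only [hPN, Matrix.sub_apply, Complex.sub_re, Finset.sum_sub_distrib]
    have h2 := hX.2
    have h3 := abs_le.mp (abs_sum_swap_le_trace hP)
    have h4 := abs_le.mp (abs_sum_swap_le_trace hN)
    linarith [h3.2, h4.1]
  rw [overlap_eq_partialTranspose]
  exact mul_le_of_le_one_right (by positivity) h

theorem proj_mul_mem_Rains {φ : EuclideanSpace ℂ (Fin a)} {η : EuclideanSpace ℂ (Fin b)}
    (hφ : ‖φ‖ = 1) (hη : ‖η‖ = 1) :
    (proj fun p : Fin a × Fin b => φ p.1 * η p.2) ∈ Rains (Fin a) (Fin b) := by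
  obtain ⟨h1, h2, h3⟩ := proj_mul_mem_PPTplus hφ hη
  refine ⟨h2, ?_⟩
  rw [traceNorm_of_posSemidef h3, trace_partialTranspose, h1, Complex.one_re]

theorem OpClass.Mem.isProductBounded {O : OpClass} {Λ : MatMap (Fin a × Fin b) (Fin m × Fin m)}
    (h : O.Mem Λ) : IsProductBounded m Λ := by
  have hlocc : ∀ {Λ : MatMap (Fin a × Fin b) (Fin m × Fin m)}, IsLOCC Λ →
      IsProductBounded m Λ := fun h => by
    obtain ⟨hpos, htp, hppt⟩ := h.isTP_and_ppt
    refine isProductBounded_of_ppt hpos htp fun φ η _ _ => ?_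
    rw [proj_mul_eq_kronecker]
    exact hppt _ _ (posSemidef_proj _) (posSemidef_proj _)
  match O, h with
  | .oneWayLOCC, h => exact hlocc (IsOneWayLOCC.isLOCC h)
  | .LOCC, h => exact hlocc h
  | .PPT, h =>
    exact isProductBounded_of_ppt (fun _ hX => h.1.1.posSemidef hX) h.1.2
      fun φ η _ _ => posSemidef_partialTranspose_of_choi h.2 φ η
  | .RainsPreserving, h =>
    exact ⟨fun _ hX => h.1.1.posSemidef hX, h.1.2, fun φ η hφ hη =>
      overlap_le_of_mem_Rains (h.2 _ (proj_mul_mem_Rains hφ hη))⟩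
  | .PPTplusPreserving, h =>
    exact isProductBounded_of_ppt (fun _ hX => h.1.1.posSemidef hX) h.1.2
      fun φ η hφ hη => (h.2 _ (proj_mul_mem_PPTplus hφ hη)).2.2
  | .SEPP, h =>
    exact isProductBounded_of_ppt (fun _ hX => h.1.1.posSemidef hX) h.1.2
      fun φ η hφ hη => (SEP_subset_PPTplus
        (h.2 _ (subset_convexHull ℝ _ ⟨φ, η, hφ, hη, rfl⟩))).2.2

end UpperBound

/-! ### One-way protocols in Kraus form belong to every class. -/

section OneWayKraus

variable {a b a' b' : ℕ} {σ τ : Type} [Fintype σ] [Fintype τ]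

/-- One-way protocols in Kraus form: Alice applies the Kraus operator `A s`, and Bob then applies
the channel with Kraus operators `B s t`. -/
def oneWayKraus (A : σ → Matrix (Fin a') (Fin a) ℂ) (B : σ → τ → Matrix (Fin b') (Fin b) ℂ) :
    MatMap (Fin a × Fin b) (Fin a' × Fin b') :=
  ∑ s, ∑ t, kraus (A s ⊗ₖ B s t)

theorem tensorMap_sum_right {α β α' β' : Type} (E : MatMap α α') (F : τ → MatMap β β') :
    tensorMap E (∑ t, F t) = ∑ t, tensorMap E (F t) := by
  simp only [tensorMap, ampRight_sum]
  ext1 X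
  simp only [LinearMap.comp_apply, LinearMap.sum_apply, map_sum]

variable {A : σ → Matrix (Fin a') (Fin a) ℂ} {B : σ → τ → Matrix (Fin b') (Fin b) ℂ}

theorem oneWayKraus_apply (X : Matrix (Fin a × Fin b) (Fin a × Fin b) ℂ) :
    oneWayKraus A B X = ∑ s, ∑ t, kraus (A s ⊗ₖ B s t) X := by
  simp only [oneWayKraus, LinearMap.sum_apply]

theorem isOneWayLOCC_oneWayKraus (hA : ∑ s, (A s)ᴴ * A s = 1)
    (hB : ∀ s, ∑ t, (B s t)ᴴ * B s t = 1) : IsOneWayLOCC (oneWayKraus A B) := by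
  let ε := (Fintype.equivFin σ).symm
  refine ⟨Fintype.card σ, fun i => kraus (A (ε i)), fun i => ∑ t, kraus (B (ε i) t),
    ⟨fun i => isCP_kraus _, ?_⟩, fun i => isCPTP_sum_kraus (hB _), ?_⟩
  · rw [Equiv.sum_comp ε fun s => kraus (A s)]
    exact isTP_sum_kraus hA
  · rw [Equiv.sum_comp ε fun s => tensorMap (kraus (A s)) (∑ t, kraus (B s t))]
    simp only [tensorMap_sum_right, tensorMap_kraus, oneWayKraus]

theorem isCPTP_oneWayKraus (hA : ∑ s, (A s)ᴴ * A s = 1)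
    (hB : ∀ s, ∑ t, (B s t)ᴴ * B s t = 1) : IsCPTP (oneWayKraus A B) := by
  rw [oneWayKraus, ← Fintype.sum_prod_type' (f := fun s t => kraus (A s ⊗ₖ B s t))]
  refine isCPTP_sum_kraus ?_
  simp only [Fintype.sum_prod_type, conjTranspose_kronecker, ← mul_kronecker_mul]
  have h : ∀ s, ∑ t, ((A s)ᴴ * A s) ⊗ₖ ((B s t)ᴴ * B s t) =
      ((A s)ᴴ * A s) ⊗ₖ (1 : Matrix (Fin b) (Fin b) ℂ) := fun s => by
    rw [← hB s]
    ext p q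
    simp only [Matrix.sum_apply, kroneckerMap_apply, Finset.mul_sum]
  simp only [h]
  rw [← one_kronecker_one, ← hA]
  ext p q
  simp only [Matrix.sum_apply, kroneckerMap_apply, Finset.sum_mul]

/-- The Choi matrix of a product Kraus operator is the rank-one operator of a product vector;
partial transposition only conjugates Bob's factor. -/
theorem posSemidef_partialTranspose_choi_oneWayKraus :
    (partialTranspose (choi (oneWayKraus A B))).PosSemidef := by
  have h : partialTranspose (choi (oneWayKraus A B)) = ∑ s, ∑ t,
      proj fun p : (Fin a × Fin a') × (Fin b × Fin b') =>
        A s p.1.2 p.1.1 * star (B s t p.2.2 p.2.1) := by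
    ext p q
    simp only [partialTranspose, choi, of_apply, oneWayKraus_apply, Matrix.sum_apply, kraus_apply]
    refine Finset.sum_congr rfl fun s _ => Finset.sum_congr rfl fun t _ => ?_
    rw [Matrix.mul_apply, Finset.sum_eq_single (q.1.1, p.2.1)]
    · rw [mul_single_apply_same]
      simp only [mul_one, proj, vecMulVec_apply, kroneckerMap_apply, conjTranspose_apply,
        Pi.star_apply, star_mul', star_star]
      ring
    · intro r _ hr
      rw [mul_single_apply_of_ne _ _ _ _ _ hr, zero_mul]
    · simp
  rw [h]
  exact posSemidef_sum _ fun s _ => posSemidef_sum _ fun t _ => posSemidef_proj _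

/-- Partial transposition intertwines a one-way protocol with the one in which Bob's Kraus
operators are conjugated. -/
theorem partialTranspose_oneWayKraus (X : Matrix (Fin a × Fin b) (Fin a × Fin b) ℂ) :
    partialTranspose (oneWayKraus A B X) =
      oneWayKraus A (fun s t => (B s t).map star) (partialTranspose X) := by
  have h : partialTransposeₗ ∘ₗ oneWayKraus A B =
      oneWayKraus A (fun s t => (B s t).map star) ∘ₗ partialTransposeₗ := by
    refine linearMap_ext_kronecker fun P Q => ?_
    simp only [LinearMap.comp_apply, oneWayKraus_apply, map_sum, kraus_kronecker,
      partialTransposeₗ_apply, partialTranspose_kronecker]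
    refine Finset.sum_congr rfl fun s _ => Finset.sum_congr rfl fun t _ => ?_
    congr 1
    have hc : ((B s t).map star)ᴴ = (B s t)ᵀ := by
      ext i j
      simp
    simp only [kraus_apply, transpose_mul, Matrix.mul_assoc, hc]
    rfl
  exact LinearMap.congr_fun h X

theorem sum_conjTranspose_mul_map_star {K : τ → Matrix (Fin b') (Fin b) ℂ}
    (hK : ∑ t, (K t)ᴴ * K t = 1) : ∑ t, ((K t).map star)ᴴ * (K t).map star = 1 := by
  have h := congrArg (fun M : Matrix (Fin b) (Fin b) ℂ => M.map star) hK
  simp only [Matrix.map_one star (star_zero ℂ) (star_one ℂ)] at h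
  rw [← h]
  ext p q
  simp [Matrix.sum_apply, Matrix.mul_apply]

/-- The map sends the optimal splitting of `Y` to a splitting of its image with the same traces. -/
theorem traceNorm_le_of_isCPTP {ι κ : Type} [Fintype ι] [Fintype κ] [DecidableEq ι]
    [DecidableEq κ] {Λ : MatMap ι κ} (hΛ : IsCPTP Λ) {Y : Matrix ι ι ℂ} (hY : Y.IsHermitian) :
    traceNorm (Λ Y) ≤ traceNorm Y := by
  obtain ⟨P, N, hP, hN, hPN, htr⟩ := exists_posSemidef_sub hY
  rw [htr, hPN, map_sub, ← hΛ.2 P, ← hΛ.2 N]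
  exact traceNorm_sub_le (hΛ.1.posSemidef hP) (hΛ.1.posSemidef hN)

theorem oneWayKraus_mem_PPTplus (hA : ∑ s, (A s)ᴴ * A s = 1)
    (hB : ∀ s, ∑ t, (B s t)ᴴ * B s t = 1) {X : Matrix (Fin a × Fin b) (Fin a × Fin b) ℂ}
    (hX : X ∈ PPTplus (Fin a) (Fin b)) : oneWayKraus A B X ∈ PPTplus (Fin a') (Fin b') := by
  obtain ⟨h1, h2, h3⟩ := hX
  refine ⟨((isCPTP_oneWayKraus hA hB).2 X).trans h1, (isCPTP_oneWayKraus hA hB).1.posSemidef h2, ?_⟩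
  rw [partialTranspose_oneWayKraus]
  exact (isCPTP_oneWayKraus hA fun s => sum_conjTranspose_mul_map_star (hB s)).1.posSemidef h3

theorem oneWayKraus_mem_Rains (hA : ∑ s, (A s)ᴴ * A s = 1)
    (hB : ∀ s, ∑ t, (B s t)ᴴ * B s t = 1) {X : Matrix (Fin a × Fin b) (Fin a × Fin b) ℂ}
    (hX : X ∈ Rains (Fin a) (Fin b)) : oneWayKraus A B X ∈ Rains (Fin a') (Fin b') := by
  refine ⟨(isCPTP_oneWayKraus hA hB).1.posSemidef hX.1, ?_⟩
  rw [partialTranspose_oneWayKraus]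
  exact (traceNorm_le_of_isCPTP
    (isCPTP_oneWayKraus hA fun s => sum_conjTranspose_mul_map_star (hB s))
    (isHermitian_partialTranspose hX.1.isHermitian)).trans hX.2

theorem proj_smul {ι : Type} (c : ℂ) (v : ι → ℂ) : proj (c • v) = (‖c‖ ^ 2 : ℝ) • proj v := by
  ext i j
  simp only [proj, vecMulVec_apply, Pi.smul_apply, Pi.star_apply, smul_eq_mul, star_mul',
    Matrix.smul_apply, Complex.real_smul]
  push_cast
  rw [← Complex.mul_conj']
  simp only [RCLike.star_def]
  ring

/-- After normalisation the squared norms become weights, and the trace condition says that they sum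
to one. -/
theorem sum_proj_mul_mem_SEP {α β : Type} [Fintype α] [Fintype β]
    (φ : σ → EuclideanSpace ℂ α) (η : σ → EuclideanSpace ℂ β)
    (h : (∑ s, proj fun p : α × β => φ s p.1 * η s p.2).trace = 1) :
    ∑ s, (proj fun p : α × β => φ s p.1 * η s p.2) ∈ SEP α β := by
  classical
  set w : σ → ℝ := fun s => (‖φ s‖ * ‖η s‖) ^ 2 with hw
  have htr : ∀ s, (proj fun p : α × β => φ s p.1 * η s p.2).trace = (w s : ℂ) := fun s => by
    rw [proj_mul_eq_kronecker, trace_kronecker, trace_proj, trace_proj, ← EuclideanSpace.norm_sq_eq,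
      ← EuclideanSpace.norm_sq_eq]
    simp only [hw]
    push_cast
    ring
  have hw1 : ∑ s, w s = 1 := by
    rw [trace_sum] at h
    simp only [htr] at h
    exact_mod_cast h
  set N : σ → Matrix (α × β) (α × β) ℂ := fun s => proj fun p : α × β =>
    ((‖φ s‖⁻¹ : ℂ) • φ s) p.1 * ((‖η s‖⁻¹ : ℂ) • η s) p.2 with hN
  have hN1 : ∀ s, (proj fun p : α × β => φ s p.1 * η s p.2) = w s • N s := fun s => by
    by_cases h1 : ‖φ s‖ = 0
    · have h2 : φ s = 0 := norm_eq_zero.mp h1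
      ext p q
      simp [hw, h2, proj, vecMulVec_apply]
    by_cases h3 : ‖η s‖ = 0
    · have h4 : η s = 0 := norm_eq_zero.mp h3
      ext p q
      simp [hw, h4, proj, vecMulVec_apply]
    have h5 : (‖φ s‖ : ℂ) ≠ 0 := by exact_mod_cast h1
    have h6 : (‖η s‖ : ℂ) ≠ 0 := by exact_mod_cast h3
    have h7 : (fun p : α × β => φ s p.1 * η s p.2) = ((‖φ s‖ * ‖η s‖ : ℝ) : ℂ) •
        fun p : α × β => ((‖φ s‖⁻¹ : ℂ) • φ s) p.1 * ((‖η s‖⁻¹ : ℂ) • η s) p.2 := by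
      funext p
      simp only [Pi.smul_apply, PiLp.smul_apply, smul_eq_mul, Complex.ofReal_mul]
      field_simp
    rw [h7, proj_smul]
    simp [hw, hN]
  -- Terms of weight zero are dropped, since a zero vector cannot be normalised to a unit vector.
  have hfil : ∑ s, (proj fun p : α × β => φ s p.1 * η s p.2) =
      ∑ s with w s ≠ 0, w s • N s := by
    rw [Finset.sum_filter_of_ne]
    · exact Finset.sum_congr rfl fun s _ => hN1 s
    · intro s _ hs h0
      rw [h0, zero_smul] at hs
      exact hs rfl
  rw [hfil]
  refine (convex_convexHull ℝ _).sum_mem (fun s _ => sq_nonneg _) ?_ fun s hs =>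
    subset_convexHull ℝ _ ⟨(‖φ s‖⁻¹ : ℂ) • φ s, (‖η s‖⁻¹ : ℂ) • η s, ?_, ?_, rfl⟩
  · rw [Finset.sum_filter_ne_zero, hw1]
  all_goals
    have h0 : (‖φ s‖ * ‖η s‖) ^ 2 ≠ 0 := (Finset.mem_filter.mp hs).2
    have h1 : ‖φ s‖ ≠ 0 := fun h => h0 (by rw [h]; simp)
    have h2 : ‖η s‖ ≠ 0 := fun h => h0 (by rw [h]; simp)
    rw [norm_smul, norm_inv, Complex.norm_real, norm_norm, inv_mul_cancel₀ (by assumption)]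

theorem kronecker_mulVec_mul {α β α' β' : Type} [Fintype α] [Fintype β] (K : Matrix α' α ℂ)
    (L : Matrix β' β ℂ) (φ : α → ℂ) (η : β → ℂ) :
    (K ⊗ₖ L) *ᵥ (fun p => φ p.1 * η p.2) = fun p => (K *ᵥ φ) p.1 * (L *ᵥ η) p.2 := by
  funext p
  simp only [mulVec, dotProduct, kroneckerMap_apply, Fintype.sum_prod_type, Finset.sum_mul_sum]
  exact Finset.sum_congr rfl fun i _ => Finset.sum_congr rfl fun j _ => by ring

theorem oneWayKraus_mem_SEP (hA : ∑ s, (A s)ᴴ * A s = 1)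
    (hB : ∀ s, ∑ t, (B s t)ᴴ * B s t = 1) {X : Matrix (Fin a × Fin b) (Fin a × Fin b) ℂ}
    (hX : X ∈ SEP (Fin a) (Fin b)) : oneWayKraus A B X ∈ SEP (Fin a') (Fin b') := by
  have himg : (oneWayKraus A B).restrictScalars ℝ '' SEP (Fin a) (Fin b) ⊆
      SEP (Fin a') (Fin b') := by
    rw [SEP, LinearMap.image_convexHull]
    refine convexHull_min ?_ (convex_convexHull ℝ _)
    rintro _ ⟨_, ⟨φ, η, hφ, hη, rfl⟩, rfl⟩
    have h1 : oneWayKraus A B (proj fun p => φ p.1 * η p.2) = ∑ st : σ × τ,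
        proj fun p : Fin a' × Fin b' => (WithLp.toLp 2 (A st.1 *ᵥ φ) : EuclideanSpace ℂ _) p.1 *
          (WithLp.toLp 2 (B st.1 st.2 *ᵥ η) : EuclideanSpace ℂ _) p.2 := by
      simp only [oneWayKraus_apply, kraus_proj, kronecker_mulVec_mul, Fintype.sum_prod_type]
    have h2 := (isCPTP_oneWayKraus hA hB).2 (proj fun p => φ p.1 * η p.2)
    rw [trace_proj_mul_eq_one hφ hη, h1] at h2
    have h3 := sum_proj_mul_mem_SEP _ _ h2
    rw [← h1] at h3
    exact h3
  exact himg ⟨X, hX, rfl⟩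

theorem mem_oneWayKraus (O : OpClass) (hA : ∑ s, (A s)ᴴ * A s = 1)
    (hB : ∀ s, ∑ t, (B s t)ᴴ * B s t = 1) : O.Mem (oneWayKraus A B) :=
  match O with
  | .oneWayLOCC => isOneWayLOCC_oneWayKraus hA hB
  | .LOCC => (isOneWayLOCC_oneWayKraus hA hB).isLOCC
  | .PPT => ⟨isCPTP_oneWayKraus hA hB, posSemidef_partialTranspose_choi_oneWayKraus⟩
  | .RainsPreserving => ⟨isCPTP_oneWayKraus hA hB, fun _ hX => oneWayKraus_mem_Rains hA hB hX⟩
  | .PPTplusPreserving => ⟨isCPTP_oneWayKraus hA hB, fun _ hX => oneWayKraus_mem_PPTplus hA hB hX⟩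
  | .SEPP => ⟨isCPTP_oneWayKraus hA hB, fun _ hX => oneWayKraus_mem_SEP hA hB hX⟩

end OneWayKraus

/-! ### Vectors in the cube as mixtures of indicators of small sets. -/

section Hypersimplex

variable {ι : Type} [Fintype ι] [DecidableEq ι]

/-- A vector in `[0, 1]^ι` with sum at most `m` is a convex combination of indicator vectors of
sets of cardinality at most `m`. -/
theorem mem_convexHull_indicator {m : ℕ} (c : ι → ℝ) (h0 : ∀ i, 0 ≤ c i) (h1 : ∀ i, c i ≤ 1)
    (hs : ∑ i, c i ≤ m) :
    c ∈ convexHull ℝ {v : ι → ℝ |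
      ∃ S : Finset ι, S.card ≤ m ∧ v = fun i => if i ∈ S then 1 else 0} := by
  set H := {v : ι → ℝ | ∃ S : Finset ι, S.card ≤ m ∧ v = fun i => if i ∈ S then 1 else 0} with hH
  -- Induction on the number of coordinates strictly between 0 and 1.
  induction hn : (Finset.univ.filter fun i => c i ≠ 0 ∧ c i ≠ 1).card using Nat.strong_induction_on
    generalizing c with
  | _ n ih =>
  by_cases hfrac : ∃ i, c i ≠ 0 ∧ c i ≠ 1
  swap
  · push Not at hfrac
    have hc : c = fun i => if i ∈ Finset.univ.filter (fun i => c i = 1) then 1 else 0 := by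
      funext i
      by_cases h : c i = 0
      · simp [h]
      · simp [hfrac i h]
    refine subset_convexHull ℝ _ ⟨Finset.univ.filter fun i => c i = 1, ?_, hc⟩
    rw [hc] at hs
    simp only [Finset.sum_ite_mem, Finset.univ_inter, Finset.sum_const, nsmul_eq_mul, mul_one] at hs
    exact_mod_cast hs
  obtain ⟨i, hi0, hi1⟩ := hfrac
  have hi0' : 0 < c i := lt_of_le_of_ne (h0 i) hi0.symm
  have hi1' : c i < 1 := lt_of_le_of_ne (h1 i) hi1
  by_cases hj : ∃ j, j ≠ i ∧ c j ≠ 0 ∧ c j ≠ 1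
  · obtain ⟨j, hji, hj0, hj1⟩ := hj
    -- Moving mass from `j` to `i` until `c i` reaches 1 or `c j` reaches 0 keeps the sum and
    -- removes a fractional coordinate. Since `c` lies between the two opposite moves, it is a
    -- convex combination of their results.
    have key : ∀ i j, i ≠ j → c i ≠ 0 → c i ≠ 1 → c j ≠ 0 → c j ≠ 1 →
        ∃ δ : ℝ, 0 < δ ∧ c + δ • (Pi.single i 1 - Pi.single j 1 : ι → ℝ) ∈ convexHull ℝ H := by
      intro i j hij hi0 hi1 hj0 hj1
      have hi1' : c i < 1 := lt_of_le_of_ne (h1 i) hi1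
      have hj0' : 0 < c j := lt_of_le_of_ne (h0 j) hj0.symm
      set δ := min (1 - c i) (c j) with hδ
      have hδ0 : 0 < δ := lt_min (by linarith) hj0'
      have hδ1 : δ ≤ 1 - c i := min_le_left _ _
      have hδ2 : δ ≤ c j := min_le_right _ _
      set c' := c + δ • (Pi.single i 1 - Pi.single j 1 : ι → ℝ) with hc'
      have ei : c' i = c i + δ := by simp [hc', hij]
      have ej : c' j = c j - δ := by simp [hc', hij.symm]; ring
      have ek : ∀ k, k ≠ i → k ≠ j → c' k = c k := fun k h h' => by simp [hc', h, h']
      refine ⟨δ, hδ0, ih _ ?_ c' ?_ ?_ ?_ rfl⟩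
      · rw [← hn]
        refine Finset.card_lt_card ⟨fun k hk => ?_, fun hsub => ?_⟩
        · simp only [Finset.mem_filter, Finset.mem_univ, true_and] at hk ⊢
          by_cases hki : k = i
          · subst hki; exact ⟨hi0, hi1⟩
          by_cases hkj : k = j
          · subst hkj; exact ⟨hj0, hj1⟩
          rwa [ek k hki hkj] at hk
        · have mi := hsub (Finset.mem_filter.mpr ⟨Finset.mem_univ i, hi0, hi1⟩)
          have mj := hsub (Finset.mem_filter.mpr ⟨Finset.mem_univ j, hj0, hj1⟩)
          simp only [Finset.mem_filter, Finset.mem_univ, true_and, ei, ej] at mi mj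
          rcases min_choice (1 - c i) (c j) with h | h
          · exact mi.2 (by rw [hδ, h]; ring)
          · exact mj.1 (by rw [hδ, h]; ring)
      · intro k
        by_cases hki : k = i
        · subst hki; rw [ei]; linarith [h0 k]
        by_cases hkj : k = j
        · subst hkj; rw [ej]; linarith
        rw [ek k hki hkj]; exact h0 k
      · intro k
        by_cases hki : k = i
        · subst hki; rw [ei]; linarith
        by_cases hkj : k = j
        · subst hkj; rw [ej]; linarith [h1 k]
        rw [ek k hki hkj]; exact h1 k
      · have : ∑ k, c' k = ∑ k, c k := by
          simp [hc', Finset.sum_add_distrib, ← Finset.mul_sum]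
        rw [this]; exact hs
    obtain ⟨δ, hδ, hmem⟩ := key i j hji.symm hi0 hi1 hj0 hj1
    obtain ⟨ε, hε, hmem'⟩ := key j i hji hj0 hj1 hi0 hi1
    have hne : δ + ε ≠ 0 := by positivity
    have hcomb : c = (ε / (δ + ε)) • (c + δ • (Pi.single i 1 - Pi.single j 1 : ι → ℝ)) +
        (δ / (δ + ε)) • (c + ε • (Pi.single j 1 - Pi.single i 1 : ι → ℝ)) := by
      funext k
      simp only [Pi.add_apply, Pi.smul_apply, Pi.sub_apply, smul_eq_mul]
      field_simp
      ring
    rw [hcomb]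
    exact convex_convexHull ℝ H hmem hmem' (by positivity) (by positivity) (by field_simp; try ring)
  · push Not at hj
    have hval : ∀ k, k ≠ i → c k =
        if k ∈ Finset.univ.filter (fun k => k ≠ i ∧ c k = 1) then 1 else 0 := by
      intro k hk
      by_cases h : c k = 0
      · simp [h]
      · simp [hj k hk h, hk]
    -- With a single fractional coordinate `i`, the coordinates equal to 1 number strictly fewer
    -- than `m` because `c i > 0`; hence `i` can be added to their set.
    have hcard : (Finset.univ.filter fun k => k ≠ i ∧ c k = 1).card + 1 ≤ m := by
      have h2 : ∑ k, c k = c i + (Finset.univ.filter fun k => k ≠ i ∧ c k = 1).card := by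
        rw [← Finset.add_sum_erase _ _ (Finset.mem_univ i),
          Finset.sum_congr rfl fun k hk => hval k (Finset.ne_of_mem_erase hk)]
        rw [Finset.sum_ite_mem, Finset.sum_const, nsmul_eq_mul, mul_one,
          Finset.inter_eq_right.mpr fun k hk => Finset.mem_erase.mpr
            ⟨(Finset.mem_filter.mp hk).2.1, Finset.mem_univ k⟩]
      rw [h2] at hs
      have : ((Finset.univ.filter fun k => k ≠ i ∧ c k = 1).card : ℝ) < m := by linarith
      exact_mod_cast this
    set S := Finset.univ.filter fun k => k ≠ i ∧ c k = 1 with hS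
    have hiS : i ∉ S := by simp [hS]
    have hcomb : c = c i • (fun k => if k ∈ insert i S then (1 : ℝ) else 0) +
        (1 - c i) • fun k => if k ∈ S then (1 : ℝ) else 0 := by
      funext k
      simp only [Pi.add_apply, Pi.smul_apply, smul_eq_mul]
      by_cases hk : k = i
      · subst hk; simp [hiS]
      · rw [hval k hk]
        by_cases hkS : k ∈ S <;> simp [hkS, hk]
    rw [hcomb]
    refine convex_convexHull ℝ H (subset_convexHull ℝ _ ⟨_, ?_, rfl⟩)
      (subset_convexHull ℝ _ ⟨_, ?_, rfl⟩) (h0 i) (by linarith) (by ring)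
    · exact (Finset.card_insert_le _ _).trans hcard
    · omega

theorem exists_subset_decomposition {m : ℕ} (c : ι → ℝ) (h0 : ∀ i, 0 ≤ c i) (h1 : ∀ i, c i ≤ 1)
    (hs : ∑ i, c i ≤ m) :
    ∃ (κ : Type) (_ : Fintype κ) (l : κ → ℝ) (S : κ → Finset ι), (∀ k, 0 ≤ l k) ∧ ∑ k, l k = 1 ∧
      (∀ k, (S k).card ≤ m) ∧ ∀ i, c i = ∑ k, if i ∈ S k then l k else 0 := by
  obtain ⟨κ, _, l, z, hl, hl1, hz, hc⟩ :=
    mem_convexHull_iff_exists_fintype.mp (mem_convexHull_indicator c h0 h1 hs)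
  choose S hS hzS using hz
  refine ⟨κ, inferInstance, l, S, hl, hl1, hS, fun i => ?_⟩
  rw [← hc]
  simp [hzS]

end Hypersimplex

/-! ### The distillation norm and its dual ball. -/

section Duality

theorem distNorm_le {d m : ℕ} {x y z : Fin d → ℂ} (h : x = y + z) :
    distNorm m x ≤ ∑ i, ‖y i‖ + √(m : ℝ) * √(∑ i, ‖z i‖ ^ 2) := by
  refine csInf_le ⟨0, ?_⟩ ⟨y, z, h, rfl⟩
  rintro _ ⟨y, z, -, rfl⟩
  positivity

/-- Intermediate value theorem. At the least positive `ξ i` more than `m` terms equal `t²`; at a `t`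
of at least the Euclidean norm of `ξ`, the sum is at most `t² ≤ m t²`. -/
theorem exists_sum_min_sq_eq {d m : ℕ} {ξ : Fin d → ℝ} (hm : 1 ≤ m) (hξ : ∀ i, 0 ≤ ξ i)
    (hcard : m < (Finset.univ.filter fun i => 0 < ξ i).card) :
    ∃ t > 0, ∑ i, min t (ξ i) ^ 2 = m * t ^ 2 := by
  set S := Finset.univ.filter fun i => 0 < ξ i with hS
  have hne : S.Nonempty := Finset.card_pos.mp (by omega)
  obtain ⟨i₀, hi₀, hmin⟩ := S.exists_min_image ξ hne
  have hε : 0 < ξ i₀ := (Finset.mem_filter.mp hi₀).2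
  set T := max (ξ i₀) (√(∑ i, ξ i ^ 2))
  have hm' : (1 : ℝ) ≤ m := by exact_mod_cast hm
  have hcont : Continuous fun t : ℝ => ∑ i, min t (ξ i) ^ 2 - m * t ^ 2 := by fun_prop
  have hmem : (0 : ℝ) ∈ Set.Icc (∑ i, min T (ξ i) ^ 2 - m * T ^ 2)
      (∑ i, min (ξ i₀) (ξ i) ^ 2 - m * ξ i₀ ^ 2) := by
    have hT : 0 ≤ T := hε.le.trans (le_max_left _ _)
    constructor
    · have h1 : ∑ i, min T (ξ i) ^ 2 ≤ ∑ i, ξ i ^ 2 := Finset.sum_le_sum fun i _ =>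
        pow_le_pow_left₀ (le_min hT (hξ i)) (min_le_right _ _) 2
      have h2 : ∑ i, ξ i ^ 2 ≤ T ^ 2 := (Real.sqrt_le_left hT).mp (le_max_right _ _)
      nlinarith [sq_nonneg T]
    · have h1 : ∑ i ∈ S, ξ i₀ ^ 2 ≤ ∑ i, min (ξ i₀) (ξ i) ^ 2 := by
        refine (Finset.sum_le_sum fun i hi => ?_).trans
          (Finset.sum_le_sum_of_subset_of_nonneg (Finset.subset_univ S) fun i _ _ => sq_nonneg _)
        rw [min_eq_left (hmin i hi)]
      rw [Finset.sum_const, nsmul_eq_mul] at h1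
      have h2 : (m : ℝ) ≤ S.card := by exact_mod_cast hcard.le
      nlinarith [sq_nonneg (ξ i₀)]
  obtain ⟨t, ht, h⟩ := intermediate_value_Icc' (le_max_left _ _) hcont.continuousOn hmem
  exact ⟨t, hε.trans_le ht.1, sub_eq_zero.mp h⟩

/-- The `m`-distillation norm of a nonnegative vector is attained by a vector in the dual ball. -/
theorem exists_dual_vector {d m : ℕ} (hm : 1 ≤ m) {ξ : Fin d → ℝ} (hξ : ∀ i, 0 ≤ ξ i) :
    ∃ w : Fin d → ℝ, (∀ i, 0 ≤ w i) ∧ (∀ i, w i ≤ 1) ∧ ∑ i, w i ^ 2 ≤ m ∧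
      distNorm m (fun i => (ξ i : ℂ)) ≤ ∑ i, w i * ξ i := by
  by_cases hcard : (Finset.univ.filter fun i => 0 < ξ i).card ≤ m
  · refine ⟨fun i => if 0 < ξ i then 1 else 0, fun i => by positivity, fun i => ?_, ?_, ?_⟩
    · dsimp only; split_ifs <;> norm_num
    · simp only [ite_pow, one_pow, ne_eq, OfNat.ofNat_ne_zero, not_false_eq_true, zero_pow,
        Finset.sum_boole]
      exact_mod_cast hcard
    · refine (distNorm_le (y := fun i => (ξ i : ℂ)) (z := 0) (by simp)).trans_eq ?_
      simp only [Pi.zero_apply, norm_zero, ne_eq, OfNat.ofNat_ne_zero, not_false_eq_true, zero_pow,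
        Finset.sum_const_zero, Real.sqrt_zero, mul_zero, add_zero, Complex.norm_real]
      refine Finset.sum_congr rfl fun i _ => ?_
      rw [Real.norm_of_nonneg (hξ i)]
      split_ifs with h
      · simp
      · linarith [hξ i]
  · obtain ⟨t, ht, hsum⟩ := exists_sum_min_sq_eq hm hξ (not_le.mp hcard)
    have hmin0 : ∀ i, 0 ≤ min t (ξ i) := fun i => le_min ht.le (hξ i)
    -- Split `ξ` at height `t`: `z` is the truncation and `y` the excess. Then `w = z / t` has
    -- squared norm `m` and equals 1 where `y ≠ 0`, so both parts pair with `w` at exactly their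
    -- cost.
    refine ⟨fun i => min t (ξ i) / t, fun i => div_nonneg (hmin0 i) ht.le,
      fun i => (div_le_one ht).mpr (min_le_left _ _), ?_, ?_⟩
    · simp only [div_pow, ← Finset.sum_div]
      rw [hsum, mul_div_cancel_right₀ _ (by positivity)]
    · refine (distNorm_le (y := fun i => ((ξ i - min t (ξ i) : ℝ) : ℂ))
        (z := fun i => ((min t (ξ i) : ℝ) : ℂ)) (by funext i; simp)).trans_eq ?_
      simp only [Complex.norm_real, Real.norm_eq_abs, sq_abs]
      rw [hsum, Real.sqrt_mul (by positivity), Real.sqrt_sq ht.le, ← mul_assoc,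
        Real.mul_self_sqrt (by positivity)]
      have h1 : (m : ℝ) * t = ∑ i, min t (ξ i) ^ 2 / t := by
        rw [← Finset.sum_div, hsum]
        field_simp
      rw [h1, ← Finset.sum_add_distrib]
      refine Finset.sum_congr rfl fun i _ => ?_
      rw [abs_of_nonneg (sub_nonneg.mpr (min_le_right _ _))]
      rcases le_total t (ξ i) with h | h
      · rw [min_eq_left h]
        field_simp
        ring
      · rw [min_eq_right h]
        field_simp
        ring

end Duality

/-! ### The optimal one-way protocol. -/

section Protocol

/-- The operator `∑_{i ∈ S} c i |g i⟩⟨e i|`. -/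
def transferOp {d n m : ℕ} (S : Finset (Fin d)) (g : Fin d → Fin m) (c : Fin d → ℝ)
    (e : Fin d → EuclideanSpace ℂ (Fin n)) : Matrix (Fin m) (Fin n) ℂ :=
  ∑ i ∈ S, (c i : ℂ) • vecMulVec (Pi.single (g i) 1) (star (e i).ofLp)

variable {d n m : ℕ} {S : Finset (Fin d)} {g : Fin d → Fin m} {c : Fin d → ℝ}
  {e : Fin d → EuclideanSpace ℂ (Fin n)}

theorem transferOp_conjTranspose_mul_self (hg : Set.InjOn g S) :
    (transferOp S g c e)ᴴ * transferOp S g c e = ∑ i ∈ S, (c i ^ 2) • proj (e i).ofLp := by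
  simp only [transferOp, conjTranspose_sum, conjTranspose_smul, conjTranspose_vecMulVec, star_star,
    Matrix.sum_mul, Matrix.mul_sum, Matrix.smul_mul, Matrix.mul_smul, vecMulVec_mul_vecMulVec]
  refine Finset.sum_congr rfl fun i hi => ?_
  rw [Finset.sum_eq_single i]
  · ext p q
    simp [proj, vecMulVec_apply]
    ring
  · intro j hj hji
    have : g j ≠ g i := fun h => hji (hg hj hi h)
    simp [this.symm]
  · exact fun h => absurd hi h

theorem transferOp_mulVec (he : Orthonormal ℂ e) (j : Fin d) :
    transferOp S g c e *ᵥ (e j).ofLp = if j ∈ S then (c j : ℂ) • Pi.single (g j) 1 else 0 := by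
  have h : ∀ i, star (e i).ofLp ⬝ᵥ (e j).ofLp = if i = j then 1 else 0 := fun i => by
    rw [dotProduct_comm, ← EuclideanSpace.inner_eq_star_dotProduct]
    exact orthonormal_iff_ite.mp he i j
  simp only [transferOp, sum_mulVec, smul_mulVec, vecMulVec_mulVec, h]
  simp

/-- Bessel's inequality, with weights at most one. -/
theorem posSemidef_one_sub_sum_proj (he : Orthonormal ℂ e) {r : Fin d → ℝ}
    (hr1 : ∀ i, r i ≤ 1) : (1 - ∑ i, r i • proj (e i).ofLp).PosSemidef := by
  have hH : (1 - ∑ i, r i • proj (e i).ofLp).IsHermitian := by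
    refine isHermitian_one.sub (isSelfAdjoint_sum _ fun i _ => ?_)
    exact (IsSelfAdjoint.all (r i)).smul (posSemidef_proj (e i).ofLp).isHermitian.isSelfAdjoint
  refine .of_dotProduct_mulVec_nonneg hH fun v => ?_
  have hb := he.sum_inner_products_le (WithLp.toLp 2 v) (s := Finset.univ)
  have h : star v ⬝ᵥ (1 - ∑ i, r i • proj (e i).ofLp) *ᵥ v =
      ((‖(WithLp.toLp 2 v : EuclideanSpace ℂ (Fin n))‖ ^ 2 -
        ∑ i, r i * ‖inner ℂ (e i) (WithLp.toLp 2 v)‖ ^ 2 : ℝ) : ℂ) := by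
    have h1 : star v ⬝ᵥ v = ((‖(WithLp.toLp 2 v : EuclideanSpace ℂ (Fin n))‖ ^ 2 : ℝ) : ℂ) := by
      rw [EuclideanSpace.norm_sq_eq]
      push_cast
      exact Finset.sum_congr rfl fun i _ => Complex.conj_mul' _
    have h2 : ∀ i, star v ⬝ᵥ proj (e i).ofLp *ᵥ v =
        ((‖inner ℂ (e i) (WithLp.toLp 2 v)‖ ^ 2 : ℝ) : ℂ) := fun i => by
      rw [EuclideanSpace.inner_eq_star_dotProduct, proj, vecMulVec_mulVec, dotProduct_smul]
      push_cast
      rw [← Complex.mul_conj', ← Complex.star_def, ← star_dotProduct_star, star_star,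
        dotProduct_comm v]
      simp [dotProduct_comm, mul_comm]
    rw [Matrix.sub_mulVec, one_mulVec, dotProduct_sub, h1, sum_mulVec, dotProduct_sum]
    simp only [smul_mulVec, dotProduct_smul, h2, Complex.real_smul]
    push_cast
    rfl
  rw [h]
  norm_cast
  refine sub_nonneg.mpr (le_trans (Finset.sum_le_sum fun i _ => ?_) hb)
  exact mul_le_of_le_one_left (sq_nonneg _) (hr1 i)

theorem overlap_proj (u : Fin m × Fin m → ℂ) :
    overlap m (proj u) = 1 / m * ‖∑ x, u (x, x)‖ ^ 2 := by
  rw [overlap_eq]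
  congr 1
  have h : ((‖∑ x, u (x, x)‖ ^ 2 : ℝ) : ℂ) = ∑ i, ∑ j, proj u (i, i) (j, j) := by
    push_cast
    rw [← Complex.mul_conj', map_sum, Finset.sum_mul_sum]
    rfl
  rw [← Complex.ofReal_re (‖∑ x, u (x, x)‖ ^ 2), h]
  simp only [Complex.re_sum]

variable {a b : ℕ}

/-- Both parties send the `i`-th Schmidt vectors to the same basis vector `g i`, so all amplitudes
land on the diagonal and add coherently. -/
theorem overlap_kraus_transferOp {e : Fin d → EuclideanSpace ℂ (Fin a)}
    {f : Fin d → EuclideanSpace ℂ (Fin b)} (he : Orthonormal ℂ e) (hf : Orthonormal ℂ f)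
    {ψ : Fin a × Fin b → ℂ} {ξ : Fin d → ℝ}
    (hψ : ∀ p, ψ p = ∑ i, (ξ i : ℂ) * (e i p.1 * f i p.2)) :
    overlap m (kraus (transferOp S g c e ⊗ₖ transferOp S g 1 f) (proj ψ)) =
      1 / m * (∑ i ∈ S, ξ i * c i) ^ 2 := by
  rw [kraus_proj, overlap_proj]
  have hψ' : ψ = ∑ i, (ξ i : ℂ) • fun p : Fin a × Fin b => e i p.1 * f i p.2 := by
    funext p
    simp [hψ p]
  have h : ∑ x, ((transferOp S g c e ⊗ₖ transferOp S g 1 f) *ᵥ ψ) (x, x) =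
      ((∑ i ∈ S, ξ i * c i : ℝ) : ℂ) := by
    rw [hψ', mulVec_sum]
    simp only [mulVec_smul, kronecker_mulVec_mul, transferOp_mulVec he, transferOp_mulVec hf,
      Finset.sum_apply, Pi.smul_apply]
    rw [Finset.sum_comm, Complex.ofReal_sum, ← Finset.sum_subset (Finset.subset_univ S)]
    · refine Finset.sum_congr rfl fun i hi => ?_
      simp [hi, Pi.single_apply]
    · intro i _ hi
      simp [hi]
  rw [h, Complex.norm_real, Real.norm_eq_abs, sq_abs]

theorem exists_injOn_of_card_le (hm : 1 ≤ m) {S : Finset (Fin d)} (hS : S.card ≤ m) :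
    ∃ g : Fin d → Fin m, Set.InjOn g S := by
  have : Nonempty (Fin m) := ⟨⟨0, hm⟩⟩
  obtain ⟨T, -, hT⟩ := Finset.exists_subset_card_eq
    (s := (Finset.univ : Finset (Fin m))) (n := S.card) (by simpa using hS)
  obtain ⟨ε⟩ := Fintype.card_eq.mp (show Fintype.card S = Fintype.card T by simp [hT])
  refine ⟨fun i => if h : i ∈ S then (ε ⟨i, h⟩ : Fin m) else Classical.arbitrary _, ?_⟩
  intro i hi j hj h
  have hi' : i ∈ S := hi
  have hj' : j ∈ S := hj
  simp only [hi', hj', dite_true] at h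
  simpa using ε.injective (Subtype.ext h)

/-- Every vector in the dual ball of the `m`-distillation norm yields a one-way protocol. -/
theorem exists_oneWayKraus_overlap_ge (hm : 1 ≤ m) {e : Fin d → EuclideanSpace ℂ (Fin a)}
    {f : Fin d → EuclideanSpace ℂ (Fin b)} (he : Orthonormal ℂ e) (hf : Orthonormal ℂ f)
    {ψ : Fin a × Fin b → ℂ} {ξ : Fin d → ℝ}
    (hψ : ∀ p, ψ p = ∑ i, (ξ i : ℂ) * (e i p.1 * f i p.2)) {w : Fin d → ℝ}
    (hw0 : ∀ i, 0 ≤ w i) (hw1 : ∀ i, w i ≤ 1) (hw : ∑ i, w i ^ 2 ≤ m) :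
    ∃ (σ τ : Type) (_ : Fintype σ) (_ : Fintype τ) (A : σ → Matrix (Fin m) (Fin a) ℂ)
      (B : σ → τ → Matrix (Fin m) (Fin b) ℂ), ∑ s, (A s)ᴴ * A s = 1 ∧
      (∀ s, ∑ t, (B s t)ᴴ * B s t = 1) ∧
      1 / m * (∑ i, w i * ξ i) ^ 2 ≤ overlap m (oneWayKraus A B (proj ψ)) := by
  obtain ⟨κ, _, l, S, hl0, hl1, hS, hlS⟩ := exists_subset_decomposition (fun i => w i ^ 2)
    (fun i => sq_nonneg _) (fun i => pow_le_one₀ (hw0 i) (hw1 i)) hw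
  choose g hg using fun k => exists_injOn_of_card_le hm (hS k)
  -- The factor `√(l k) / w i` makes `∑ KᴴK` the projection onto the `e i` with `w i ≠ 0`. If `w i =
  -- 0`, Lean's division gives 0, and `e i` is left to the completion.
  set K : κ → Matrix (Fin m) (Fin a) ℂ :=
    fun k => transferOp (S k) (g k) (fun i => √(l k) / w i) e with hK
  set V : κ → Matrix (Fin m) (Fin b) ℂ := fun k => transferOp (S k) (g k) 1 f with hV
  have hKK : ∑ k, (K k)ᴴ * K k = ∑ i, (if w i = 0 then (0 : ℝ) else 1) • proj (e i).ofLp := by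
    simp only [hK, transferOp_conjTranspose_mul_self (hg _), div_pow, Real.sq_sqrt (hl0 _)]
    have h1 : ∀ k, ∑ i ∈ S k, (l k / w i ^ 2) • proj (e i).ofLp =
        ∑ i, ((if i ∈ S k then l k else 0) / w i ^ 2) • proj (e i).ofLp := fun k => by
      rw [← Finset.sum_subset (Finset.subset_univ (S k))]
      · exact Finset.sum_congr rfl fun i hi => by rw [if_pos hi]
      · intro i _ hi
        rw [if_neg hi, zero_div, zero_smul]
    simp only [h1]
    rw [Finset.sum_comm]
    refine Finset.sum_congr rfl fun i _ => ?_
    rw [← Finset.sum_smul, ← Finset.sum_div, ← hlS i]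
    by_cases h : w i = 0
    · simp [h]
    · simp [h]
  have hVV : ∀ k, (1 - (V k)ᴴ * V k).PosSemidef := fun k => by
    have h1 : (V k)ᴴ * V k = ∑ i, (if i ∈ S k then (1 : ℝ) else 0) • proj (f i).ofLp := by
      rw [hV, transferOp_conjTranspose_mul_self (hg k)]
      simp [ite_smul, Finset.sum_ite_mem]
    rw [h1]
    exact posSemidef_one_sub_sum_proj hf fun i => by split_ifs <;> norm_num
  obtain ⟨L, hL⟩ := exists_kraus_completion K (by
    rw [hKK]
    exact posSemidef_one_sub_sum_proj he fun i => by split_ifs <;> norm_num) ⟨0, hm⟩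
  -- The outcomes in `Fin a` complete Alice's measurement. There Bob's operator `Sum.elim V 0`
  -- vanishes and any completion will do, as these outcomes only need a nonnegative overlap.
  have hcompl : ∀ s : κ ⊕ Fin a, ∃ M : Fin b → Matrix (Fin m) (Fin b) ℂ,
      ∑ _t : Unit, (Sum.elim V 0 s)ᴴ * Sum.elim V 0 s + ∑ j, (M j)ᴴ * M j = 1 := fun s =>
    exists_kraus_completion (fun _ : Unit => Sum.elim V 0 s) (by
      rcases s with k | j
      · simpa using hVV k
      · simpa using Matrix.PosSemidef.one) ⟨0, hm⟩
  choose M hM using hcompl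
  refine ⟨κ ⊕ Fin a, Unit ⊕ Fin b, inferInstance, inferInstance, Sum.elim K L,
    fun s => Sum.elim (fun _ => Sum.elim V 0 s) (M s), ?_, fun s => ?_, ?_⟩
  · rw [Fintype.sum_sum_type]
    exact hL
  · rw [Fintype.sum_sum_type]
    exact hM s
  have hnn : ∀ N : Matrix (Fin m × Fin m) (Fin a × Fin b) ℂ, 0 ≤ overlap m (kraus N (proj ψ)) :=
    fun N => by
      rw [kraus_proj]
      exact overlap_nonneg (posSemidef_proj _)
  rw [oneWayKraus_apply, overlap_sum]
  simp only [overlap_sum]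
  simp only [Fintype.sum_sum_type, Sum.elim_inl, Sum.elim_inr, Finset.univ_unique,
    Finset.sum_singleton]
  have hsum : ∑ k, overlap m (kraus (K k ⊗ₖ V k) (proj ψ)) =
      1 / m * ∑ k, l k * (∑ i ∈ S k, ξ i / w i) ^ 2 := by
    rw [Finset.mul_sum]
    refine Finset.sum_congr rfl fun k _ => ?_
    rw [hK, hV, overlap_kraus_transferOp he hf hψ]
    congr 1
    rw [← Real.sq_sqrt (hl0 k), ← mul_pow, Finset.mul_sum, Real.sqrt_sq (Real.sqrt_nonneg _)]
    congr 1
    exact Finset.sum_congr rfl fun i _ => by ring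
  -- The sets `S k` containing `i` have total weight `w i ^ 2`, which turns `ξ i / w i` into `w i *
  -- ξ i`; when `w i = 0` both sides vanish.
  have hmean : ∑ i, w i * ξ i = ∑ k, l k * ∑ i ∈ S k, ξ i / w i := by
    have h1 : ∀ k, l k * ∑ i ∈ S k, ξ i / w i =
        ∑ i, (if i ∈ S k then l k else 0) * (ξ i / w i) := fun k => by
      simp [Finset.mul_sum, ite_mul, Finset.sum_ite_mem]
    simp only [h1]
    rw [Finset.sum_comm]
    refine Finset.sum_congr rfl fun i _ => ?_
    rw [← Finset.sum_mul, ← hlS i]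
    by_cases h : w i = 0
    · simp [h]
    · field_simp
  have hjensen : (∑ i, w i * ξ i) ^ 2 ≤ ∑ k, l k * (∑ i ∈ S k, ξ i / w i) ^ 2 := by
    rw [hmean]
    have := (even_two.convexOn_pow (𝕜 := ℝ)).map_sum_le (t := Finset.univ) (w := l)
      (p := fun k => ∑ i ∈ S k, ξ i / w i) (fun k _ => hl0 k) hl1 fun _ _ => Set.mem_univ _
    simpa [smul_eq_mul] using this
  calc 1 / m * (∑ i, w i * ξ i) ^ 2
      ≤ 1 / m * ∑ k, l k * (∑ i ∈ S k, ξ i / w i) ^ 2 := by gcongr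
    _ = ∑ k, overlap m (kraus (K k ⊗ₖ V k) (proj ψ)) := hsum.symm
    _ ≤ ∑ k, (overlap m (kraus (K k ⊗ₖ V k) (proj ψ)) +
          ∑ j, overlap m (kraus (K k ⊗ₖ M (Sum.inl k) j) (proj ψ))) :=
        Finset.sum_le_sum fun k _ => le_add_of_nonneg_right (Finset.sum_nonneg fun j _ => hnn _)
    _ ≤ _ := le_add_of_nonneg_right (Finset.sum_nonneg fun j _ =>
        add_nonneg (hnn _) (Finset.sum_nonneg fun j _ => hnn _))

end Protocol

end Distillation

end

/-! ### The two bounds combined. -/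

theorem mainTheorem1 {a b : ℕ} (ψ : EuclideanSpace ℂ (Fin a × Fin b)) (hψ : ‖ψ‖ = 1)
    (ξ : Fin (min a b) → ℝ) (hξ : Distillation.IsSchmidtVector ψ ξ)
    (m : ℕ) (hm : 1 ≤ m) (O : Distillation.OpClass) :
    Distillation.fidelity O (Distillation.proj ψ) m =
      1 / (m : ℝ) * Distillation.distNorm m (fun i => (ξ i : ℂ)) ^ 2 := by
  have hm' : (0 : ℝ) < m := by exact_mod_cast hm
  have hne : {t : ℝ | ∃ y z : Fin (min a b) → ℂ, (fun i => (ξ i : ℂ)) = y + z ∧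
      t = ∑ i, ‖y i‖ + √(m : ℝ) * √(∑ i, ‖z i‖ ^ 2)}.Nonempty := ⟨_, _, 0, (add_zero _).symm, rfl⟩
  have hnorm0 : 0 ≤ Distillation.distNorm m (fun i => (ξ i : ℂ)) := by
    refine Real.sInf_nonneg ?_
    rintro _ ⟨y, z, -, rfl⟩
    positivity
  have hub : ∀ t ∈ {t : ℝ | ∃ Λ : Distillation.MatMap (Fin a × Fin b) (Fin m × Fin m), O.Mem Λ ∧
      t = (((Λ (Distillation.proj ψ)).conjTranspose *
        Distillation.proj (Distillation.maxEntVec m)).trace).re},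
      t ≤ 1 / (m : ℝ) * Distillation.distNorm m (fun i => (ξ i : ℂ)) ^ 2 := by
    rintro _ ⟨Λ, hΛ, rfl⟩
    rw [Distillation.re_trace_conjTranspose_mul_proj]
    change Distillation.overlap m _ ≤ _
    have h1 : √(m * Distillation.overlap m (Λ (Distillation.proj ψ))) ≤
        Distillation.distNorm m (fun i => (ξ i : ℂ)) := by
      refine le_csInf hne ?_
      rintro _ ⟨y, z, hyz, rfl⟩
      exact hΛ.isProductBounded.overlap_le hm hξ hyz
    rw [one_div, le_inv_mul_iff₀ hm']
    exact (Real.sqrt_le_left hnorm0).mp h1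
  obtain ⟨e, f, he, hf, hξ0, hψe⟩ := hξ
  obtain ⟨w, hw0, hw1, hw, hdist⟩ := Distillation.exists_dual_vector hm hξ0
  obtain ⟨σ, τ, _, _, A, B, hA, hB, hAB⟩ :=
    Distillation.exists_oneWayKraus_overlap_ge hm he hf hψe hw0 hw1 hw
  have hmem := Distillation.mem_oneWayKraus O hA hB
  -- The explicit protocol also shows that the set of achievable values is nonempty, without which
  -- `sSup` would not be bounded by `csSup_le`.
  refine le_antisymm (csSup_le ⟨_, _, hmem, rfl⟩ hub) ?_
  refine le_csSup_of_le ⟨_, hub⟩ ⟨_, hmem, rfl⟩ ?_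
  rw [Distillation.re_trace_conjTranspose_mul_proj]
  refine le_trans ?_ hAB
  gcongr
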